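/- Let $M\ge 2$ and $1\le T<N$ be integers, and put $d=\gcd(N,T)$, $n=N/d$, $t=T/d$. A PIR scheme for $M$ records $W_1,\dots,W_M$ (random variables on a finite alphabet, independent and of equal entropy) replicated on $N$ servers consists of a random seed $S$ independent of the records, query functions giving, for each wanted index $\theta$, queries $Q_\theta^{(j)}$ ($1\le j\le N$) as functions of $(\theta,S)$ in finite alphabets, and answer functions giving $A_\theta^{(j)}$ as a function of $Q_\theta^{(j)}$ and $(W_1,\dots,W_M)$ in finite alphabets. It is a $T$-private PIR scheme if it is correct ($W_\theta$ is determined by $\theta$, $S$ and $A_\theta^{(1)},\dots,A_\theta^{(N)}$) and $T$-private (for every set $\Gamma$ of at most $T$ servers, the joint distribution of $(Q_\theta^{(j)})_{j\in\Gamma}$, $(A_\theta^{(j)})_{j\in\Gamma}$ and $(W_1,\dots,W_M)$ does not depend on $\theta$). Its rate is $H(W_\theta)/\sum_{j=1}^N H(A_\theta^{(j)})$, where $H$ is Shannon entropy. The capacity is the supremum of the rates of all $T$-private PIR schemes with $M$ records and $N$ replicated servers, and a $T$-private PIR scheme is capacity-achieving if its rate equals the capacity. A scheme is linear over a finite field $\mathbb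 F_q$ with sub-packetization $L$ if the records are independent and uniformly distributed row vectors in $\mathbb F_q^L$, the query $Q_\theta^{(j)}$ is a tuple of matrices $Q_{\theta,i}^{(j)}\in\mathbb F_q^{L\times\gamma_j}$ $(1\le i\le M)$, and $A_\theta^{(j)}=\sum_{i=1}^M W_iQ_{\theta,i}^{(j)}\in\mathbb F_q^{\gamma_j}$. Then the smallest sub-packetization $L$ of a linear capacity-achieving $T$-private PIR scheme with $M$ records and $N$ replicated servers, over any finite field, is exactly $d\,n^{M-1}$. Moreover, over every finite field $\mathbb F_q$ with $q\ge\max\{N t^{M-2},\,N(n-t)^{M-2}\}$ there is a linear capacity-achieving $T$-private PIR scheme with sub-packetization $d\,n^{M-1}$, and its rate is $$\frac{1-T/N}{1-(T/N)^M}.$$ -/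

import Mathlib

/-- Shannon entropy (in nats) of a distribution on a finite set.  The unit plays no role below:
entropies occur only in comparisons and in quotients of two entropies. -/
noncomputable def shannonEntropy {α : Type} [Fintype α] (p : PMF α) : ℝ :=
  ∑ a, Real.negMulLog (p a).toReal

/-- The data of a private information retrieval scheme with `M` records replicated on each of `N`
servers.  The user draws a secret seed, independently of the records; wanting record `θ`, he sends
`query θ seed j` to server `j`, who replies with `answer j` of the received query and of the
records.  The conditions on the records, correctness and privacy are separate predicates below. -/
structure PIRScheme (M N : ℕ) where
  Record : Type
  Seed : Type
  Query : Fin N → Type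
  Answer : Fin N → Type
  [recordFintype : Fintype Record]
  [queryFintype : ∀ j, Fintype (Query j)]
  [answerFintype : ∀ j, Fintype (Answer j)]
  /-- the joint distribution of the `M` records -/
  recordLaw : PMF (Fin M → Record)
  /-- the distribution of the private random resources of the user -/
  seedLaw : PMF Seed
  /-- the query function -/
  query : Fin M → Seed → (j : Fin N) → Query j
  /-- the answer function of each server -/
  answer : (j : Fin N) → Query j → (Fin M → Record) → Answer j

attribute [instance] PIRScheme.recordFintype PIRScheme.queryFintype PIRScheme.answerFintype

namespace PIRScheme

variable {M N : ℕ} (P : PIRScheme M N)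

/-- The distribution of the single record `i`. -/
noncomputable def singleRecordLaw (i : Fin M) : PMF P.Record :=
  P.recordLaw.map fun w => w i

/-- The distribution of the answer of server `j` when record `θ` is wanted (over the seed and the
records). -/
noncomputable def answerLaw (θ : Fin M) (j : Fin N) : PMF (P.Answer j) :=
  P.seedLaw.bind fun s => P.recordLaw.map fun w => P.answer j (P.query θ s j) w

/-- The joint distribution of everything that the servers in `Γ` hold when record `θ` is wanted:
their queries, their answers, and all the records. -/
noncomputable def viewLaw (θ : Fin M) (Γ : Finset (Fin N)) :
    PMF (((j : Γ) → P.Query j) × ((j : Γ) → P.Answer j) × (Fin M → P.Record)) :=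
  P.seedLaw.bind fun s => P.recordLaw.map fun w =>
    (fun j => P.query θ s j, fun j => P.answer j (P.query θ s j) w, w)

/-- The records are independent and have the same entropy. -/
def IndependentEqualSizeRecords : Prop :=
  shannonEntropy P.recordLaw = ∑ i, shannonEntropy (P.singleRecordLaw i) ∧
    ∀ i i' : Fin M, shannonEntropy (P.singleRecordLaw i) = shannonEntropy (P.singleRecordLaw i')

/-- Correctness: the wanted record is a function of its index, of the seed (which determines all
the queries) and of the answers of all servers. -/
def IsCorrect : Prop :=
  ∀ θ : Fin M, ∃ decode : P.Seed → ((j : Fin N) → P.Answer j) → P.Record,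
    ∀ s ∈ P.seedLaw.support, ∀ w ∈ P.recordLaw.support,
      decode s (fun j => P.answer j (P.query θ s j) w) = w θ

/-- `T`-privacy: what any at most `T` servers hold is independent of the index of the wanted
record, i.e. has the same distribution for all indices. -/
def IsPrivate (T : ℕ) : Prop :=
  ∀ Γ : Finset (Fin N), Γ.card ≤ T → ∀ θ θ' : Fin M, P.viewLaw θ Γ = P.viewLaw θ' Γ

/-- `P` is a `T`-private PIR scheme. -/
structure IsTPrivatePIR (T : ℕ) : Prop where
  records : P.IndependentEqualSizeRecords
  correct : P.IsCorrect
  isPrivate : P.IsPrivate T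

/-- The rate: the entropy of the wanted record over the sum of the entropies of the answers. -/
noncomputable def rate (θ : Fin M) : ℝ :=
  shannonEntropy (P.singleRecordLaw θ) / ∑ j, shannonEntropy (P.answerLaw θ j)

/-- The scheme has rate `R`, whichever record is wanted. -/
def HasRate (R : ℝ) : Prop :=
  ∀ θ : Fin M, P.rate θ = R

end PIRScheme

/-- The capacity: the supremum of the rates of all (not only linear) `T`-private PIR schemes with
`M` records and `N` replicated servers. -/
noncomputable def pirCapacity (M N T : ℕ) : ℝ :=
  sSup {R : ℝ | ∃ P : PIRScheme M N, P.IsTPrivatePIR T ∧ P.HasRate R}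

/-- A linear scheme over the finite field `F` with sub-packetization `L`: every record is a vector
in `F ^ L`, the query to server `j` consists of an `L × γ j` matrix for each record, and server `j`
answers with the sum over all records of (record as a row vector) times (matrix). -/
structure LinearPIRScheme (F : Type) [Field F] [Fintype F] (M N L : ℕ) where
  Seed : Type
  seedLaw : PMF Seed
  γ : Fin N → ℕ
  query : Fin M → Seed → (j : Fin N) → Fin M → Matrix (Fin L) (Fin (γ j)) F

namespace LinearPIRScheme

variable {F : Type} [Field F] [Fintype F] {M N L : ℕ}

open Classical in
/-- A linear scheme as a PIR scheme; all coordinates of all records are independent and uniformly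
distributed. -/
noncomputable def toPIRScheme (S : LinearPIRScheme F M N L) : PIRScheme M N where
  Record := Fin L → F
  Seed := S.Seed
  Query j := Fin M → Matrix (Fin L) (Fin (S.γ j)) F
  Answer j := Fin (S.γ j) → F
  recordLaw := PMF.uniformOfFintype (Fin M → Fin L → F)
  seedLaw := S.seedLaw
  query := S.query
  answer _ Q w := ∑ i, Matrix.vecMul (w i) (Q i)

/-- The linear scheme is a `T`-private PIR scheme and its rate is the capacity. -/
def IsCapacityAchieving (S : LinearPIRScheme F M N L) (T : ℕ) : Prop :=
  S.toPIRScheme.IsTPrivatePIR T ∧ S.toPIRScheme.HasRate (pirCapacity M N T)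

end LinearPIRScheme

/-- `L` is the sub-packetization of some linear capacity-achieving `T`-private PIR scheme with `M`
records and `N` replicated servers, over some finite field. -/
def IsAchievableSubpacketization (M N T L : ℕ) : Prop :=
  ∃ (F : Type) (_ : Field F) (_ : Fintype F) (S : LinearPIRScheme F M N L),
    S.IsCapacityAchieving T

/-!
The capacity is `1 / (1 + x + ⋯ + x ^ (M - 1))` with `x = T / N`, and the optimal sub-packetization
is read off from the equality case of the converse.

*Converse.*  For fixed queries `q`, let `condEntropy q Γ K` be the conditional entropy, given the
records in `K`, of the answers of the servers in `Γ`; it is submodular in `Γ`.  If `θ ∉ K` is wanted,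
the answers of all servers reveal record `θ`, so that giving this record too lowers the entropy by
exactly that of one record (`condEntropy_univ_eq_add`).  By privacy, the mean entropy of the answers
of any `T` servers does not change when another record is wanted, and by Han's inequality its average
over all sets of `T` servers is at least `T / N` times the entropy of all answers
(`ratio_mul_queryMean_le`).  Alternating the two steps until all records are given bounds the download
from below (`downloadCost_mul_le_sum`).

*Lower bound on the sub-packetization.*  If the rate is the capacity, all these inequalities are
equalities, for each query in the support (`condEntropy_of_hasRate`).  In a linear scheme all the
conditional entropies are integers in units of `log |F|`.  For `T = 1`, the strict concavity of
entropy shows that the total dimension of the answers is the same for all queries; it is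
`L (1 + ⋯ + x ^ (M - 1))`, and as `n` and `t` are coprime, `n ^ (M - 1)` divides `L`.  For `T ≥ 2`,
the equality case of Han's inequality shows that a single answer, given all but `m < M` of the
records, has dimension `(L / N) (1 + ⋯ + x ^ (m - 1))` (`condEntropy_singleton_of_hasRate`); the
values `m = 1` and `m = M - 1` give that `N n ^ (M - 2) = d n ^ (M - 1)` divides `L`.

*Scheme.*  For each nonempty set `K` of `k + 1` records, the servers are asked for altogether
`d (n - t) ^ k t ^ (M - 1 - k)` sums of one part of each record in `K`.  The parts of the wanted
record `θ` are its `L` coordinates in a random basis.  For each nonempty `K ∌ θ`, the sums of the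
unwanted parts in the symbols of types `K` and `K ∪ {θ}` are the coordinates of one word of an MDS
(Vandermonde) code of rate `T / N`, of which every server sees equally many coordinates.  The symbols
of type `K` determine the word, so that it can be removed from those of type `K ∪ {θ}`
(`eq_zero_of_dotProduct_designVec`); any `T` servers see only linearly independent vectors of each
record, whichever record is wanted (`linearIndependent_designVec`), and the random change of basis
makes these indistinguishable.  Distributing the symbols evenly enough over the servers is a matter
of rounding (`symbolCount_add_succ`, `sum_symbolCount`).
-/

/-! ### Entropy of a partition of a finite probability space -/

open Classical in
/-- The mass of the class of `a` in the partition `r`. -/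
noncomputable def classMass {Ω : Type*} [Fintype Ω] (p : Ω → ℝ) (r : Setoid Ω) (a : Ω) : ℝ :=
  ∑ b with r a b, p b

/-- The entropy of the partition of the finite probability space `(Ω, p)` into the classes of `r`.
A random variable `f` on `Ω` enters through `Setoid.ker f`, and the joint variable of two random
variables through the infimum of their partitions. -/
noncomputable def partEntropy {Ω : Type*} [Fintype Ω] (p : Ω → ℝ) (r : Setoid Ω) : ℝ :=
  -∑ a, p a * Real.log (classMass p r a)

section PartitionEntropy

variable {Ω : Type*} [Fintype Ω] {p : Ω → ℝ}

theorem classMass_congr {r : Setoid Ω} {a b : Ω} (h : r a b) : classMass p r a = classMass p r b := by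
  classical
  unfold classMass
  congr 1
  ext c
  simp only [Finset.mem_filter, Finset.mem_univ, true_and]
  exact ⟨fun hc => r.trans (r.symm h) hc, fun hc => r.trans h hc⟩

theorem classMass_nonneg (hp : ∀ a, 0 ≤ p a) (r : Setoid Ω) (a : Ω) : 0 ≤ classMass p r a :=
  Finset.sum_nonneg fun b _ => hp b

theorem le_classMass (hp : ∀ a, 0 ≤ p a) (r : Setoid Ω) (a : Ω) : p a ≤ classMass p r a := by
  classical
  exact Finset.single_le_sum (f := p) (fun b _ => hp b) (by simp)

/-- Refining a partition, up to points of mass zero, does not decrease its entropy. -/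
theorem partEntropy_le_of_imp (hp : ∀ a, 0 ≤ p a) {r s : Setoid Ω}
    (h : ∀ a b, p a ≠ 0 → p b ≠ 0 → r a b → s a b) : partEntropy p s ≤ partEntropy p r := by
  classical
  refine neg_le_neg (Finset.sum_le_sum fun a _ => ?_)
  rcases (hp a).eq_or_lt with h0 | h0
  · simp [← h0]
  refine mul_le_mul_of_nonneg_left (Real.log_le_log (h0.trans_le (le_classMass hp r a)) ?_) h0.le
  unfold classMass
  rw [Finset.sum_filter, Finset.sum_filter]
  refine Finset.sum_le_sum fun b _ => ?_
  by_cases hb : p b = 0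
  · simp [hb]
  by_cases hr : r a b
  · simp [hr, h a b h0.ne' hb hr]
  · rw [if_neg hr]
    split_ifs
    exacts [hp b, le_rfl]

theorem partEntropy_mono (hp : ∀ a, 0 ≤ p a) {r s : Setoid Ω} (h : r ≤ s) :
    partEntropy p s ≤ partEntropy p r :=
  partEntropy_le_of_imp hp fun _ _ _ _ hr => h hr

theorem partEntropy_top (h1 : ∑ a, p a = 1) : partEntropy p ⊤ = 0 := by
  have : ∀ a, classMass p (⊤ : Setoid Ω) a = 1 := fun a => by
    unfold classMass
    rw [← h1]
    congr 1
    ext b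
    simp [Setoid.top_def]
  simp [partEntropy, this]

/-- The core of the submodularity of entropy: for `r, s ≤ u` the ratios below have mean at most
one. -/
theorem sum_mul_classMass_ratio_le_one (hp : ∀ a, 0 ≤ p a) (h1 : ∑ a, p a = 1) {r s u : Setoid Ω}
    (hr : r ≤ u) (hs : s ≤ u) :
    ∑ a, p a * (classMass p r a * classMass p s a / (classMass p (r ⊓ s) a * classMass p u a))
      ≤ 1 := by
  classical
  have e1 : ∀ a, p a * (classMass p r a * classMass p s a /
      (classMass p (r ⊓ s) a * classMass p u a)) = ∑ b, ∑ c, p b * p c *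
        (if r a b ∧ s a c then p a / (classMass p (r ⊓ s) a * classMass p u a) else 0) := by
    intro a
    have : classMass p r a * classMass p s a
        = ∑ b, ∑ c, p b * p c * (if r a b ∧ s a c then 1 else 0) := by
      rw [classMass, classMass, Finset.sum_filter, Finset.sum_filter, Finset.sum_mul_sum]
      refine Finset.sum_congr rfl fun b _ => Finset.sum_congr rfl fun c _ => ?_
      by_cases h₁ : r a b <;> by_cases h₂ : s a c <;> simp [h₁, h₂]
    rw [this, mul_div_assoc', mul_comm (p a), mul_div_assoc, Finset.sum_mul]
    refine Finset.sum_congr rfl fun b _ => ?_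
    rw [Finset.sum_mul]
    refine Finset.sum_congr rfl fun c _ => ?_
    split_ifs <;> ring
  have e2 : ∀ b c, ∑ a, (if r a b ∧ s a c then p a / (classMass p (r ⊓ s) a * classMass p u a)
      else 0) ≤ if u b c then 1 / classMass p u b else 0 := by
    intro b c
    by_cases h : ∃ a₀, r a₀ b ∧ s a₀ c
    · obtain ⟨a₀, hb, hc⟩ := h
      have hub : u a₀ b := hr hb
      have huc : u a₀ c := hs hc
      rw [if_pos (u.trans (u.symm hub) huc)]
      have key : ∀ a, (if r a b ∧ s a c then p a / (classMass p (r ⊓ s) a * classMass p u a)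
          else 0) = (if (r ⊓ s) a₀ a then p a else 0) *
            (1 / (classMass p (r ⊓ s) a₀ * classMass p u b)) := by
        intro a
        by_cases h : r a b ∧ s a c
        · have h' : (r ⊓ s) a₀ a := ⟨r.trans hb (r.symm h.1), s.trans hc (s.symm h.2)⟩
          rw [if_pos h, if_pos h', ← classMass_congr h', ← classMass_congr (hr h.1)]
          ring
        · have h' : ¬ (r ⊓ s) a₀ a := fun h' =>
            h ⟨r.trans (r.symm h'.1) hb, s.trans (s.symm h'.2) hc⟩
          rw [if_neg h, if_neg h', zero_mul]
      rw [Finset.sum_congr rfl fun a _ => key a, ← Finset.sum_mul, ← Finset.sum_filter]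
      change classMass p (r ⊓ s) a₀ * _ ≤ _
      rcases (classMass_nonneg hp (r ⊓ s) a₀).eq_or_lt with h0 | h0
      · rw [← h0, zero_mul]
        exact one_div_nonneg.2 (classMass_nonneg hp u b)
      · apply le_of_eq
        rw [mul_one_div, mul_comm, div_mul_cancel_right₀ h0.ne', one_div]
    · rw [Finset.sum_eq_zero]
      · split_ifs
        exacts [one_div_nonneg.2 (classMass_nonneg hp u b), le_rfl]
      · intro a _
        rw [if_neg fun h' => h ⟨a, h'⟩]
  calc _ = ∑ b, ∑ c, p b * p c * ∑ a, (if r a b ∧ s a c then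
          p a / (classMass p (r ⊓ s) a * classMass p u a) else 0) := by
        rw [Finset.sum_congr rfl fun a _ => e1 a, Finset.sum_comm]
        refine Finset.sum_congr rfl fun b _ => ?_
        rw [Finset.sum_comm]
        refine Finset.sum_congr rfl fun c _ => ?_
        rw [Finset.mul_sum]
    _ ≤ ∑ b, ∑ c, p b * p c * (if u b c then 1 / classMass p u b else 0) := by
        gcongr with b _ c _
        · exact mul_nonneg (hp b) (hp c)
        · exact e2 b c
    _ ≤ ∑ b, p b := by
        refine Finset.sum_le_sum fun b _ => ?_
        have : ∑ c, p b * p c * (if u b c then 1 / classMass p u b else 0)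
            = p b * (classMass p u b / classMass p u b) := by
          generalize hx : classMass p u b = x
          nth_rewrite 2 [← hx]
          rw [classMass, Finset.sum_div, Finset.mul_sum, Finset.sum_filter]
          refine Finset.sum_congr rfl fun c _ => ?_
          split_ifs
          · rw [mul_one_div, mul_div_assoc]
          · simp
        rw [this]
        exact mul_le_of_le_one_right (hp b) (div_self_le_one _)
    _ = 1 := h1

/-- Submodularity of entropy. -/
theorem partEntropy_inf_add_le (hp : ∀ a, 0 ≤ p a) (h1 : ∑ a, p a = 1) {r s u : Setoid Ω}
    (hr : r ≤ u) (hs : s ≤ u) :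
    partEntropy p (r ⊓ s) + partEntropy p u ≤ partEntropy p r + partEntropy p s := by
  have key : ∀ a, p a * (Real.log (classMass p r a) + Real.log (classMass p s a)
      - Real.log (classMass p (r ⊓ s) a) - Real.log (classMass p u a))
      ≤ p a * (classMass p r a * classMass p s a / (classMass p (r ⊓ s) a * classMass p u a))
        - p a := by
    intro a
    rcases (hp a).eq_or_lt with h0 | h0
    · simp [← h0]
    have pos : ∀ v : Setoid Ω, 0 < classMass p v a := fun v => h0.trans_le (le_classMass hp v a)
    have hlog := Real.log_le_sub_one_of_pos
      (div_pos (mul_pos (pos r) (pos s)) (mul_pos (pos (r ⊓ s)) (pos u)))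
    rw [Real.log_div (mul_pos (pos r) (pos s)).ne' (mul_pos (pos (r ⊓ s)) (pos u)).ne',
      Real.log_mul (pos r).ne' (pos s).ne', Real.log_mul (pos (r ⊓ s)).ne' (pos u).ne'] at hlog
    have := mul_le_mul_of_nonneg_left hlog h0.le
    linarith
  have hsum := Finset.sum_le_sum fun a (_ : a ∈ Finset.univ) => key a
  rw [Finset.sum_sub_distrib, h1] at hsum
  have hle := sum_mul_classMass_ratio_le_one hp h1 hr hs
  simp only [mul_sub, mul_add, Finset.sum_sub_distrib, Finset.sum_add_distrib] at hsum
  unfold partEntropy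
  linarith

end PartitionEntropy

/-- The probability of a value of a random variable, as a finite sum of real numbers. -/
theorem PMF.toReal_map_apply {α β : Type*} [Fintype α] [DecidableEq β] (P : PMF α) (f : α → β)
    (b : β) : (P.map f b).toReal = ∑ a with f a = b, (P a).toReal := by
  classical
  rw [PMF.map_apply, tsum_fintype, ENNReal.toReal_sum, Finset.sum_filter]
  · refine Finset.sum_congr rfl fun a _ => ?_
    by_cases h : f a = b
    · simp [h]
    · simp [h, Ne.symm h]
  · intro a _
    split_ifs
    exacts [P.apply_ne_top a, ENNReal.zero_ne_top]

theorem PMF.sum_toReal {α : Type*} [Fintype α] (P : PMF α) : ∑ a, (P a).toReal = 1 := by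
  rw [← ENNReal.toReal_sum fun a _ => P.apply_ne_top a, ← tsum_fintype (L := .unconditional _),
    P.tsum_coe, ENNReal.toReal_one]

/-- The Shannon entropy of a random variable is the entropy of the partition into its fibres. -/
theorem shannonEntropy_map {α β : Type} [Fintype α] [Fintype β] (P : PMF α) (f : α → β) :
    shannonEntropy (P.map f) = partEntropy (fun a => (P a).toReal) (Setoid.ker f) := by
  classical
  unfold shannonEntropy partEntropy
  rw [← Finset.sum_fiberwise Finset.univ f, ← Finset.sum_neg_distrib]
  refine Finset.sum_congr rfl fun b _ => ?_
  rw [PMF.toReal_map_apply, Real.negMulLog, neg_mul, Finset.sum_mul]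
  congr 1
  refine Finset.sum_congr rfl fun a ha => ?_
  congr 2
  unfold classMass
  refine Finset.sum_congr ?_ fun _ _ => rfl
  ext c
  rw [← (Finset.mem_filter.1 ha).2]
  simp [Setoid.ker_def, eq_comm]

theorem shannonEntropy_eq_partEntropy {α : Type} [Fintype α] (P : PMF α) :
    shannonEntropy P = partEntropy (fun a => (P a).toReal) ⊥ := by
  conv_lhs => rw [← P.map_id]
  rw [shannonEntropy_map]
  congr 1

theorem shannonEntropy_nonneg {α : Type} [Fintype α] (P : PMF α) : 0 ≤ shannonEntropy P :=
  Finset.sum_nonneg fun a _ => Real.negMulLog_nonneg ENNReal.toReal_nonneg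
    (ENNReal.toReal_mono ENNReal.one_ne_top (P.coe_le_one a))

theorem shannonEntropy_le_log_card {α : Type} [Fintype α] (P : PMF α) :
    shannonEntropy P ≤ Real.log (Fintype.card α) := by
  have hne : Nonempty α := P.support_nonempty.to_type
  have hc : (0 : ℝ) < Fintype.card α := by exact_mod_cast Fintype.card_pos
  have h := Real.concaveOn_negMulLog.le_map_sum (t := Finset.univ)
    (w := fun _ : α => (1 / Fintype.card α : ℝ)) (p := fun a => (P a).toReal)
    (fun _ _ => by positivity) (by simp [hc.ne']) (fun a _ => ENNReal.toReal_nonneg)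
  simp only [smul_eq_mul, ← Finset.mul_sum, PMF.sum_toReal] at h
  change 1 / (Fintype.card α : ℝ) * shannonEntropy P ≤ _ at h
  rw [Real.negMulLog, mul_one, one_div, Real.log_inv, neg_mul_neg] at h
  exact le_of_mul_le_mul_left h (by positivity)

/-! ### Submodular functions and Han's inequality -/

section Han

variable {N : ℕ}

/-- If all sums of a function over `T`-subsets agree, `1 ≤ T < N`, the function is constant. -/
theorem eq_of_sum_powersetCard_const {T : ℕ} (hT : 1 ≤ T) (hTN : T < N) {x : Fin N → ℝ} {r : ℝ}
    (h : ∀ Γ : Finset (Fin N), Γ.card = T → ∑ j ∈ Γ, x j = r) (i j : Fin N) : x i = x j := by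
  rcases eq_or_ne i j with rfl | hij
  · rfl
  obtain ⟨Δ, hΔ, hc⟩ := Finset.exists_subset_card_eq
    (s := (Finset.univ.erase i).erase j) (n := T - 1) (by
      rw [Finset.card_erase_of_mem (by simp [hij.symm]), Finset.card_erase_of_mem (by simp),
        Finset.card_univ, Fintype.card_fin]
      omega)
  have hi : i ∉ Δ := fun hi => by simpa using hΔ hi
  have hj : j ∉ Δ := fun hj => by simpa using hΔ hj
  have h₁ := h (insert i Δ) (by rw [Finset.card_insert_of_notMem hi]; omega)
  have h₂ := h (insert j Δ) (by rw [Finset.card_insert_of_notMem hj]; omega)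
  rw [Finset.sum_insert hi] at h₁
  rw [Finset.sum_insert hj] at h₂
  linarith

theorem eq_of_sum_powersetCard_eq {T : ℕ} (hT : 1 ≤ T) (hTN : T < N) {x y : Fin N → ℝ}
    (h : ∀ Γ : Finset (Fin N), Γ.card = T → ∑ j ∈ Γ, x j = ∑ j ∈ Γ, y j) (j : Fin N) :
    x j = y j := by
  have hz : ∀ Γ : Finset (Fin N), Γ.card = T → ∑ j ∈ Γ, (x j - y j) = 0 := fun Γ hΓ => by
    rw [Finset.sum_sub_distrib, h Γ hΓ, sub_self]
  obtain ⟨Γ, -, hΓ⟩ := Finset.exists_subset_card_eq (s := (Finset.univ : Finset (Fin N))) (n := T)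
    (by simpa using hTN.le)
  have h0 := hz Γ hΓ
  rw [Finset.sum_congr rfl fun i _ => eq_of_sum_powersetCard_const hT hTN hz i j,
    Finset.sum_const, hΓ, nsmul_eq_mul] at h0
  have hT' : (T : ℝ) ≠ 0 := by exact_mod_cast (by omega : T ≠ 0)
  linarith [(mul_eq_zero.1 h0).resolve_left hT']

theorem sum_powersetCard_sum {T : ℕ} (hT : 1 ≤ T) (x : Fin N → ℝ) :
    ∑ Γ ∈ Finset.powersetCard T (Finset.univ : Finset (Fin N)), ∑ j ∈ Γ, x j
      = (N - 1).choose (T - 1) * ∑ j, x j := by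
  have h : ∀ Γ : Finset (Fin N), ∑ j ∈ Γ, x j = ∑ j, if j ∈ Γ then x j else 0 := fun Γ => by
    rw [Finset.sum_ite_mem, Finset.univ_inter]
  rw [Finset.sum_congr rfl fun Γ _ => h Γ, Finset.sum_comm, Finset.mul_sum]
  refine Finset.sum_congr rfl fun j _ => ?_
  rw [← Finset.sum_filter, Finset.sum_const, nsmul_eq_mul]
  congr 2
  have e : (Finset.powersetCard T (Finset.univ : Finset (Fin N))).filter (j ∈ ·)
      = (Finset.powersetCard (T - 1) (Finset.univ.erase j)).image (insert j) := by
    ext Γ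
    simp only [Finset.mem_filter, Finset.mem_powersetCard, Finset.mem_image, Finset.subset_univ,
      true_and]
    constructor
    · rintro ⟨hc, hj⟩
      refine ⟨Γ.erase j, ⟨Finset.erase_subset_erase _ (Finset.subset_univ _), ?_⟩,
        Finset.insert_erase hj⟩
      rw [Finset.card_erase_of_mem hj, hc]
    · rintro ⟨Δ, ⟨hs, hc⟩, rfl⟩
      refine ⟨?_, Finset.mem_insert_self _ _⟩
      rw [Finset.card_insert_of_notMem fun h => by simpa using hs h]
      omega
  rw [e, Finset.card_image_of_injOn, Finset.card_powersetCard,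
    Finset.card_erase_of_mem (Finset.mem_univ _), Finset.card_univ, Fintype.card_fin]
  intro Δ hΔ Δ' hΔ' heq
  have h1 : j ∉ Δ := fun h => by simpa using (Finset.mem_powersetCard.1 hΔ).1 h
  have h2 : j ∉ Δ' := fun h => by simpa using (Finset.mem_powersetCard.1 hΔ').1 h
  rw [← Finset.erase_insert h1, ← Finset.erase_insert h2]
  exact congrArg (Finset.erase · j) heq

/-- A normalized submodular set function. -/
structure IsSubmodular (f : Finset (Fin N) → ℝ) : Prop where
  empty : f ∅ = 0
  union_add_inter_le : ∀ A B, f (A ∪ B) + f (A ∩ B) ≤ f A + f B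

/-- The increment of `f` when `j` is added to the elements that precede it in the order given by
`ρ`. -/
def chainIncrement (f : Finset (Fin N) → ℝ) (ρ : Fin N → ℕ) (j : Fin N) : ℝ :=
  f {i | ρ i < ρ j + 1} - f {i | ρ i < ρ j}

variable {f : Finset (Fin N) → ℝ} {ρ : Fin N → ℕ}

theorem sum_chainIncrement_le (hf : IsSubmodular f) (hρ : Function.Injective ρ)
    (Γ : Finset (Fin N)) : ∑ j ∈ Γ, chainIncrement f ρ j ≤ f Γ := by
  induction Γ using Finset.induction_on_max_value ρ with
  | empty => simp [hf.empty]
  | insert a s ha hmax ih =>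
    rw [Finset.sum_insert ha]
    have hsub := hf.union_add_inter_le (insert a s) {i | ρ i < ρ a}
    have e1 : insert a s ∪ Finset.univ.filter (fun i => ρ i < ρ a)
        = Finset.univ.filter (fun i => ρ i < ρ a + 1) := by
      ext i
      simp only [Finset.mem_union, Finset.mem_insert, Finset.mem_filter, Finset.mem_univ, true_and,
        Nat.lt_succ_iff]
      constructor
      · rintro ((rfl | h) | h)
        exacts [le_rfl, hmax i h, h.le]
      · intro h
        rcases h.eq_or_lt with h | h
        exacts [Or.inl (Or.inl (hρ h)), Or.inr h]
    have e2 : insert a s ∩ Finset.univ.filter (fun i => ρ i < ρ a) = s := by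
      ext i
      simp only [Finset.mem_inter, Finset.mem_insert, Finset.mem_filter, Finset.mem_univ, true_and]
      constructor
      · rintro ⟨rfl | h, h'⟩
        exacts [absurd h' (lt_irrefl _), h]
      · intro h
        exact ⟨Or.inr h, lt_of_le_of_ne (hmax i h) fun h' => ha (hρ h' ▸ h)⟩
    rw [e1, e2] at hsub
    unfold chainIncrement at ih ⊢
    linarith

theorem sum_univ_chainIncrement (hf : IsSubmodular f) (hρ : Function.Injective ρ) :
    ∑ j, chainIncrement f ρ j = f Finset.univ := by
  have key : ∀ m, ∑ j with ρ j < m, chainIncrement f ρ j = f {j | ρ j < m} := by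
    intro m
    induction m with
    | zero => simp [hf.empty]
    | succ m ih =>
      by_cases hm : ∃ a, ρ a = m
      · obtain ⟨a, rfl⟩ := hm
        have e : Finset.univ.filter (fun i => ρ i < ρ a + 1)
            = insert a (Finset.univ.filter fun i => ρ i < ρ a) := by
          ext i
          simp only [Finset.mem_insert, Finset.mem_filter, Finset.mem_univ, true_and,
            Nat.lt_succ_iff, le_iff_eq_or_lt, hρ.eq_iff]
        rw [e, Finset.sum_insert (by simp), ih, ← e, chainIncrement, sub_add_cancel]
      · have e : Finset.univ.filter (fun i => ρ i < m + 1)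
            = Finset.univ.filter fun i => ρ i < m := by
          ext i
          simp only [Finset.mem_filter, Finset.mem_univ, true_and]
          have : ρ i ≠ m := fun h => hm ⟨i, h⟩
          omega
        rw [e, ih]
  have e : Finset.univ.filter (fun i => ρ i < Finset.univ.sup ρ + 1) = Finset.univ := by
    ext i
    simp only [Finset.mem_filter, Finset.mem_univ, true_and, iff_true, Nat.lt_succ_iff]
    exact Finset.le_sup (Finset.mem_univ i)
  have h := key (Finset.univ.sup ρ + 1)
  rwa [e] at h

/-- Han's inequality. -/
theorem IsSubmodular.choose_mul_le (hf : IsSubmodular f) {T : ℕ} (hT : 1 ≤ T) :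
    (N - 1).choose (T - 1) * f Finset.univ
      ≤ ∑ Γ ∈ Finset.powersetCard T (Finset.univ : Finset (Fin N)), f Γ := by
  rw [← sum_univ_chainIncrement hf Fin.val_injective, ← sum_powersetCard_sum hT]
  exact Finset.sum_le_sum fun Γ _ => sum_chainIncrement_le hf Fin.val_injective Γ

/-- Equality in Han's inequality forces `f` to be additive over the `T`-subsets and over the whole
set: the increments along all orders agree, because they have the same sums over `T`-subsets, and
the increment of the first element is the value at a singleton. -/
theorem IsSubmodular.additive_of_choose_mul_eq (hf : IsSubmodular f) {T : ℕ} (hT : 1 ≤ T)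
    (hTN : T < N) (h : (N - 1).choose (T - 1) * f Finset.univ
      = ∑ Γ ∈ Finset.powersetCard T (Finset.univ : Finset (Fin N)), f Γ) :
    (∀ Γ : Finset (Fin N), Γ.card = T → f Γ = ∑ j ∈ Γ, f {j}) ∧ f Finset.univ = ∑ j, f {j} := by
  have hsum : ∀ {ρ : Fin N → ℕ}, Function.Injective ρ →
      ∀ Γ : Finset (Fin N), Γ.card = T → ∑ j ∈ Γ, chainIncrement f ρ j = f Γ := by
    intro ρ hρ Γ hΓ
    rw [← sum_univ_chainIncrement hf hρ, ← sum_powersetCard_sum hT] at h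
    exact (Finset.sum_eq_sum_iff_of_le fun Γ _ => sum_chainIncrement_le hf hρ Γ).1 h Γ
      (by simp [Finset.mem_powersetCard, hΓ])
  have hsingle : ∀ j, chainIncrement f Fin.val j = f {j} := by
    intro j
    -- an order in which `j` comes first
    set ρ : Fin N → ℕ := fun i => if i = j then 0 else i.val + 1 with hρdef
    have hρ : Function.Injective ρ := by
      intro a b hab
      simp only [hρdef] at hab
      split_ifs at hab <;> omega
    rw [eq_of_sum_powersetCard_eq hT hTN (x := chainIncrement f Fin.val) (y := chainIncrement f ρ)
      (fun Γ hΓ => by rw [hsum Fin.val_injective Γ hΓ, hsum hρ Γ hΓ]) j]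
    have hj : ρ j = 0 := by simp [hρdef]
    have e : Finset.univ.filter (fun i => ρ i < 1) = {j} := by
      ext i
      simp [hρdef]
    rw [chainIncrement, hj, zero_add, e]
    simp [hf.empty]
  refine ⟨fun Γ hΓ => ?_, ?_⟩
  · rw [← hsum Fin.val_injective Γ hΓ]
    exact Finset.sum_congr rfl fun j _ => hsingle j
  · rw [← sum_univ_chainIncrement hf Fin.val_injective]
    exact Finset.sum_congr rfl fun j _ => hsingle j

end Han

/-! ### Entropies of the answers given some of the records -/

namespace PIRScheme

variable {M N : ℕ} (P : PIRScheme M N)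

/-- The joint distribution of the queries to all servers when record `θ` is wanted. -/
noncomputable def queryLaw (θ : Fin M) : PMF ((j : Fin N) → P.Query j) :=
  P.seedLaw.map (P.query θ)

/-- The probability of a tuple of records, as a real number. -/
noncomputable def recordProb (w : Fin M → P.Record) : ℝ := (P.recordLaw w).toReal

/-- The partition of the record tuples by the values of the records in `K`. -/
def recordPart (K : Finset (Fin M)) : Setoid (Fin M → P.Record) where
  r a b := ∀ i ∈ K, a i = b i
  iseqv := ⟨fun _ _ _ => rfl, fun h i hi => (h i hi).symm,
    fun h h' i hi => (h i hi).trans (h' i hi)⟩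

/-- The partition of the record tuples by the answers of the servers in `Γ` to the queries `q`. -/
def answerPart (q : (j : Fin N) → P.Query j) (Γ : Finset (Fin N)) :
    Setoid (Fin M → P.Record) where
  r a b := ∀ j ∈ Γ, P.answer j (q j) a = P.answer j (q j) b
  iseqv := ⟨fun _ _ _ => rfl, fun h i hi => (h i hi).symm,
    fun h h' i hi => (h i hi).trans (h' i hi)⟩

/-- The conditional entropy, given the records in `K`, of the answers of the servers in `Γ` to the
fixed queries `q`. -/
noncomputable def condEntropy (q : (j : Fin N) → P.Query j) (Γ : Finset (Fin N))
    (K : Finset (Fin M)) : ℝ :=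
  partEntropy P.recordProb (P.answerPart q Γ ⊓ P.recordPart K)
    - partEntropy P.recordProb (P.recordPart K)

/-- The mean of a function of the queries when record `θ` is wanted. -/
noncomputable def queryMean (θ : Fin M) (φ : ((j : Fin N) → P.Query j) → ℝ) : ℝ :=
  ∑ q, (P.queryLaw θ q).toReal * φ q

variable {P}

theorem recordProb_nonneg (w : Fin M → P.Record) : 0 ≤ P.recordProb w := ENNReal.toReal_nonneg

theorem sum_recordProb : ∑ w, P.recordProb w = 1 := P.recordLaw.sum_toReal

theorem recordPart_iff {K : Finset (Fin M)} {a b : Fin M → P.Record} :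
    P.recordPart K a b ↔ ∀ i ∈ K, a i = b i := Iff.rfl

theorem answerPart_iff {q : (j : Fin N) → P.Query j} {Γ : Finset (Fin N)}
    {a b : Fin M → P.Record} :
    P.answerPart q Γ a b ↔ ∀ j ∈ Γ, P.answer j (q j) a = P.answer j (q j) b := Iff.rfl

theorem answerPart_empty (q : (j : Fin N) → P.Query j) : P.answerPart q ∅ = ⊤ := by
  ext a b
  simp [answerPart_iff, Setoid.top_def]

theorem recordPart_empty : P.recordPart ∅ = ⊤ := by
  ext a b
  simp [recordPart_iff, Setoid.top_def]

theorem answerPart_union (q : (j : Fin N) → P.Query j) (A B : Finset (Fin N)) :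
    P.answerPart q (A ∪ B) = P.answerPart q A ⊓ P.answerPart q B := by
  ext a b
  exact ⟨fun h => ⟨fun j hj => h j (Finset.mem_union_left _ hj),
    fun j hj => h j (Finset.mem_union_right _ hj)⟩,
    fun h j hj => (Finset.mem_union.1 hj).elim (h.1 j) (h.2 j)⟩

theorem recordPart_union (A B : Finset (Fin M)) :
    P.recordPart (A ∪ B) = P.recordPart A ⊓ P.recordPart B := by
  ext a b
  exact ⟨fun h => ⟨fun j hj => h j (Finset.mem_union_left _ hj),
    fun j hj => h j (Finset.mem_union_right _ hj)⟩,
    fun h j hj => (Finset.mem_union.1 hj).elim (h.1 j) (h.2 j)⟩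

theorem answerPart_anti (q : (j : Fin N) → P.Query j) {A B : Finset (Fin N)} (h : A ⊆ B) :
    P.answerPart q B ≤ P.answerPart q A := fun _ _ hab j hj => hab j (h hj)

theorem isSubmodular_condEntropy (q : (j : Fin N) → P.Query j) (K : Finset (Fin M)) :
    IsSubmodular fun Γ => P.condEntropy q Γ K where
  empty := by simp [condEntropy, answerPart_empty]
  union_add_inter_le A B := by
    have h := partEntropy_inf_add_le recordProb_nonneg sum_recordProb
      (r := P.answerPart q A ⊓ P.recordPart K) (s := P.answerPart q B ⊓ P.recordPart K)
      (u := P.answerPart q (A ∩ B) ⊓ P.recordPart K)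
      (inf_le_inf_right _ (answerPart_anti q Finset.inter_subset_left))
      (inf_le_inf_right _ (answerPart_anti q Finset.inter_subset_right))
    rw [← inf_inf_distrib_right, ← answerPart_union] at h
    simp only [condEntropy]
    linarith

theorem condEntropy_mono (q : (j : Fin N) → P.Query j) {A B : Finset (Fin N)} (h : A ⊆ B)
    (K : Finset (Fin M)) : P.condEntropy q A K ≤ P.condEntropy q B K :=
  sub_le_sub_right (partEntropy_mono recordProb_nonneg
    (inf_le_inf_right _ (answerPart_anti q h))) _

theorem condEntropy_congr {q q' : (j : Fin N) → P.Query j} {Γ : Finset (Fin N)}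
    (h : ∀ j ∈ Γ, q j = q' j) (K : Finset (Fin M)) :
    P.condEntropy q Γ K = P.condEntropy q' Γ K := by
  have : P.answerPart q Γ = P.answerPart q' Γ := by
    ext a b
    exact forall₂_congr fun j hj => by rw [h j hj]
  rw [condEntropy, this, condEntropy]

theorem condEntropy_univ_right (q : (j : Fin N) → P.Query j) (Γ : Finset (Fin N)) :
    P.condEntropy q Γ Finset.univ = 0 := by
  have : P.answerPart q Γ ⊓ P.recordPart Finset.univ = P.recordPart Finset.univ := by
    refine inf_eq_right.2 fun a b hab => ?_
    have : a = b := funext fun i => hab i (Finset.mem_univ i)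
    rw [this]
  rw [condEntropy, this, sub_self]

theorem condEntropy_singleton_empty (q : (j : Fin N) → P.Query j) (j : Fin N) :
    P.condEntropy q {j} ∅ = shannonEntropy (P.recordLaw.map (P.answer j (q j))) := by
  have : P.answerPart q {j} = Setoid.ker (P.answer j (q j)) := by
    ext a b
    simp [answerPart_iff, Setoid.ker_def]
  rw [shannonEntropy_map, condEntropy, recordPart_empty, partEntropy_top sum_recordProb, sub_zero,
    inf_top_eq, this]
  rfl

theorem shannonEntropy_singleRecordLaw (i : Fin M) :
    shannonEntropy (P.singleRecordLaw i) = partEntropy P.recordProb (P.recordPart {i}) := by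
  rw [singleRecordLaw, shannonEntropy_map]
  congr 1
  ext a b
  simp [recordPart_iff, Setoid.ker_def]

/-- Independent records of equal entropy: any `k` of them have `k` times the entropy of one. -/
theorem partEntropy_recordPart (h : P.IndependentEqualSizeRecords) (θ : Fin M)
    (K : Finset (Fin M)) : partEntropy P.recordProb (P.recordPart K)
      = K.card * shannonEntropy (P.singleRecordLaw θ) := by
  have hsub : ∀ A B : Finset (Fin M), partEntropy P.recordProb (P.recordPart (A ∪ B))
      ≤ partEntropy P.recordProb (P.recordPart A) + partEntropy P.recordProb (P.recordPart B) := by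
    intro A B
    have := partEntropy_inf_add_le (recordProb_nonneg (P := P)) sum_recordProb
      (r := P.recordPart A) (s := P.recordPart B) (u := ⊤) le_top le_top
    rwa [partEntropy_top sum_recordProb, add_zero, ← recordPart_union] at this
  have hle : ∀ A : Finset (Fin M), partEntropy P.recordProb (P.recordPart A)
      ≤ A.card * shannonEntropy (P.singleRecordLaw θ) := by
    intro A
    induction A using Finset.induction_on with
    | empty => simp [recordPart_empty, partEntropy_top sum_recordProb]
    | insert i A hi ih =>
      rw [Finset.card_insert_of_notMem hi, Finset.insert_eq]
      refine (hsub _ _).trans ?_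
      rw [← shannonEntropy_singleRecordLaw, h.2 i θ]
      push_cast
      linarith
  have huniv : partEntropy P.recordProb (P.recordPart Finset.univ)
      = M * shannonEntropy (P.singleRecordLaw θ) := by
    have e : P.recordPart Finset.univ = ⊥ := by
      ext a b
      simp [recordPart_iff, funext_iff]
    have h1 := h.1
    rw [shannonEntropy_eq_partEntropy, Finset.sum_congr rfl fun i _ => h.2 i θ] at h1
    rw [e]
    rw [Finset.sum_const, Finset.card_univ, Fintype.card_fin, nsmul_eq_mul] at h1
    exact h1
  refine le_antisymm (hle K) ?_
  have h1 := hsub K Kᶜ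
  rw [Finset.union_compl, huniv] at h1
  have h2 := hle Kᶜ
  rw [Finset.card_compl, Fintype.card_fin, Nat.cast_sub (by simpa using K.card_le_univ)] at h2
  linarith

theorem mem_support_queryLaw {θ : Fin M} {q : (j : Fin N) → P.Query j} :
    q ∈ (P.queryLaw θ).support ↔ ∃ s ∈ P.seedLaw.support, P.query θ s = q := by
  simp [queryLaw]

/-- All answers together reveal the wanted record. -/
theorem condEntropy_univ_eq_add (hr : P.IndependentEqualSizeRecords) (hc : P.IsCorrect)
    {θ : Fin M} {K : Finset (Fin M)} (hθ : θ ∉ K) {q : (j : Fin N) → P.Query j}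
    (hq : q ∈ (P.queryLaw θ).support) :
    P.condEntropy q Finset.univ K
      = shannonEntropy (P.singleRecordLaw θ) + P.condEntropy q Finset.univ (insert θ K) := by
  obtain ⟨s, hs, rfl⟩ := mem_support_queryLaw.1 hq
  obtain ⟨decode, hdec⟩ := hc θ
  have e : partEntropy P.recordProb (P.answerPart (P.query θ s) Finset.univ ⊓ P.recordPart K)
      = partEntropy P.recordProb
        (P.answerPart (P.query θ s) Finset.univ ⊓ P.recordPart (insert θ K)) := by
    apply le_antisymm
    · refine partEntropy_le_of_imp recordProb_nonneg fun a b ha hb hab => ⟨hab.1, fun i hi => ?_⟩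
      exact hab.2 i (Finset.mem_insert_of_mem hi)
    · refine partEntropy_le_of_imp recordProb_nonneg fun a b ha hb hab => ⟨hab.1, fun i hi => ?_⟩
      rcases Finset.mem_insert.1 hi with rfl | hi
      · have mem : ∀ w, P.recordProb w ≠ 0 → w ∈ P.recordLaw.support := fun w hw h0 =>
          hw (by rw [recordProb, h0, ENNReal.toReal_zero])
        rw [← hdec s hs a (mem a ha), ← hdec s hs b (mem b hb)]
        congr 1
        exact funext fun j => hab.1 j (Finset.mem_univ j)
      · exact hab.2 i hi
  rw [condEntropy, condEntropy, e, partEntropy_recordPart hr θ, partEntropy_recordPart hr θ,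
    Finset.card_insert_of_notMem hθ]
  push_cast
  ring

theorem queryMean_add (θ : Fin M) (φ ψ : ((j : Fin N) → P.Query j) → ℝ) :
    P.queryMean θ (fun q => φ q + ψ q) = P.queryMean θ φ + P.queryMean θ ψ := by
  simp only [queryMean, mul_add, Finset.sum_add_distrib]

theorem queryMean_sum {ι : Type*} (s : Finset ι) (θ : Fin M)
    (φ : ι → ((j : Fin N) → P.Query j) → ℝ) :
    P.queryMean θ (fun q => ∑ i ∈ s, φ i q) = ∑ i ∈ s, P.queryMean θ (φ i) := by
  simp only [queryMean, Finset.mul_sum]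
  exact Finset.sum_comm

theorem queryMean_const (θ : Fin M) (c : ℝ) : P.queryMean θ (fun _ => c) = c := by
  rw [queryMean, ← Finset.sum_mul, PMF.sum_toReal, one_mul]

theorem queryMean_const_mul (θ : Fin M) (c : ℝ) (φ : ((j : Fin N) → P.Query j) → ℝ) :
    P.queryMean θ (fun q => c * φ q) = c * P.queryMean θ φ := by
  rw [queryMean, queryMean, Finset.mul_sum]
  exact Finset.sum_congr rfl fun q _ => by ring

theorem toReal_queryLaw_pos {θ : Fin M} {q : (j : Fin N) → P.Query j}
    (hq : q ∈ (P.queryLaw θ).support) : 0 < (P.queryLaw θ q).toReal :=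
  ENNReal.toReal_pos hq (PMF.apply_ne_top _ _)

theorem toReal_queryLaw_eq_zero {θ : Fin M} {q : (j : Fin N) → P.Query j}
    (hq : q ∉ (P.queryLaw θ).support) : (P.queryLaw θ q).toReal = 0 := by
  rw [(PMF.apply_eq_zero_iff _ _).2 hq, ENNReal.toReal_zero]

theorem queryMean_mono {θ : Fin M} {φ ψ : ((j : Fin N) → P.Query j) → ℝ}
    (h : ∀ q ∈ (P.queryLaw θ).support, φ q ≤ ψ q) : P.queryMean θ φ ≤ P.queryMean θ ψ := by
  refine Finset.sum_le_sum fun q _ => ?_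
  by_cases hq : q ∈ (P.queryLaw θ).support
  · exact mul_le_mul_of_nonneg_left (h q hq) ENNReal.toReal_nonneg
  · simp [toReal_queryLaw_eq_zero hq]

theorem queryMean_congr {θ : Fin M} {φ ψ : ((j : Fin N) → P.Query j) → ℝ}
    (h : ∀ q ∈ (P.queryLaw θ).support, φ q = ψ q) : P.queryMean θ φ = P.queryMean θ ψ :=
  le_antisymm (queryMean_mono fun q hq => (h q hq).le) (queryMean_mono fun q hq => (h q hq).ge)

/-- Ordered functions with the same mean agree on the support. -/
theorem eq_of_queryMean_eq {θ : Fin M} {φ ψ : ((j : Fin N) → P.Query j) → ℝ}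
    (h : ∀ q, φ q ≤ ψ q) (heq : P.queryMean θ φ = P.queryMean θ ψ)
    {q : (j : Fin N) → P.Query j} (hq : q ∈ (P.queryLaw θ).support) : φ q = ψ q :=
  mul_left_cancel₀ (toReal_queryLaw_pos hq).ne' ((Finset.sum_eq_sum_iff_of_le fun q _ =>
    mul_le_mul_of_nonneg_left (h q) ENNReal.toReal_nonneg).1 heq q (Finset.mem_univ q))

theorem map_restrict_queryLaw_eq {T : ℕ} (h : P.IsPrivate T) {Γ : Finset (Fin N)}
    (hΓ : Γ.card ≤ T) (θ θ' : Fin M) :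
    (P.queryLaw θ).map (fun q (j : Γ) => q j) = (P.queryLaw θ').map (fun q (j : Γ) => q j) := by
  have key : ∀ θ, (P.queryLaw θ).map (fun q (j : Γ) => q j) = (P.viewLaw θ Γ).map Prod.fst := by
    intro θ
    simp only [viewLaw, queryLaw, PMF.map_bind, PMF.map_comp]
    rw [← PMF.bind_pure_comp]
    congr 1
    funext s
    exact (PMF.map_const _ _).symm
  rw [key, key, h Γ hΓ θ θ']

theorem queryMean_eq_of_private {T : ℕ} (h : P.IsPrivate T) {Γ : Finset (Fin N)}
    (hΓ : Γ.card ≤ T) (θ θ' : Fin M) {φ : ((j : Fin N) → P.Query j) → ℝ}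
    (hφ : ∀ q q', (∀ j ∈ Γ, q j = q' j) → φ q = φ q') :
    P.queryMean θ φ = P.queryMean θ' φ := by
  classical
  obtain ⟨ψ, rfl⟩ : ∃ ψ : ((j : Γ) → P.Query j) → ℝ, φ = ψ ∘ fun q (j : Γ) => q j :=
    (Function.factorsThrough_iff φ).1 fun q q' hqq' =>
      hφ q q' fun j hj => congrFun hqq' ⟨j, hj⟩
  have key : ∀ θ, P.queryMean θ (ψ ∘ fun q (j : Γ) => q j)
      = ∑ r, ((P.queryLaw θ).map (fun q (j : Γ) => q j) r).toReal * ψ r := by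
    intro θ
    rw [queryMean, ← Finset.sum_fiberwise Finset.univ fun q (j : Γ) => q j]
    refine Finset.sum_congr rfl fun r _ => ?_
    rw [PMF.toReal_map_apply, Finset.sum_mul]
    refine Finset.sum_congr rfl fun q hq => ?_
    rw [Function.comp_apply, (Finset.mem_filter.1 hq).2]
  rw [key, key, map_restrict_queryLaw_eq h hΓ θ θ']

theorem exists_mem_support_of_private {T : ℕ} (h : P.IsPrivate T) {Γ : Finset (Fin N)}
    (hΓ : Γ.card ≤ T) (θ θ' : Fin M) {q : (j : Fin N) → P.Query j}
    (hq : q ∈ (P.queryLaw θ).support) :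
    ∃ q' ∈ (P.queryLaw θ').support, ∀ j ∈ Γ, q' j = q j := by
  have hmem : (fun j : Γ => q j) ∈ ((P.queryLaw θ).map (fun q (j : Γ) => q j)).support :=
    (PMF.mem_support_map_iff _ _ _).2 ⟨q, hq, rfl⟩
  rw [map_restrict_queryLaw_eq h hΓ θ θ'] at hmem
  obtain ⟨q', hq', e⟩ := (PMF.mem_support_map_iff _ _ _).1 hmem
  exact ⟨q', hq', fun j hj => congrFun e ⟨j, hj⟩⟩

end PIRScheme

/-! ### The converse bound on the rate -/

/-- The download cost, per unit of record entropy, forced by `m` records. -/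
noncomputable def downloadCost (N T m : ℕ) : ℝ := ∑ k ∈ Finset.range m, ((T : ℝ) / N) ^ k

theorem downloadCost_succ (N T m : ℕ) :
    downloadCost N T (m + 1) = 1 + (T : ℝ) / N * downloadCost N T m := by
  rw [downloadCost, Finset.sum_range_succ', pow_zero, add_comm, downloadCost, Finset.mul_sum]
  congr 1
  exact Finset.sum_congr rfl fun k _ => pow_succ' _ _

theorem downloadCost_pos (N T : ℕ) {m : ℕ} (hm : m ≠ 0) : 0 < downloadCost N T m := by
  obtain ⟨m, rfl⟩ := Nat.exists_eq_succ_of_ne_zero hm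
  rw [downloadCost_succ]
  have : 0 ≤ downloadCost N T m := Finset.sum_nonneg fun k _ => by positivity
  positivity

theorem one_div_downloadCost {N T : ℕ} (hTN : T < N) (m : ℕ) :
    1 / downloadCost N T m = (1 - (T : ℝ) / N) / (1 - ((T : ℝ) / N) ^ m) := by
  have hN : (0 : ℝ) < N := by exact_mod_cast (Nat.zero_le T).trans_lt hTN
  have hx : 1 - (T : ℝ) / N ≠ 0 := by
    rw [sub_ne_zero]
    exact ((div_lt_one hN).2 (by exact_mod_cast hTN)).ne'
  rw [← mul_neg_geom_sum, ← downloadCost, one_div, div_mul_cancel_left₀ hx]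

namespace PIRScheme

variable {M N T : ℕ} {P : PIRScheme M N}

theorem toReal_answerLaw (θ : Fin M) (j : Fin N) (a : P.Answer j) :
    (P.answerLaw θ j a).toReal
      = ∑ q, (P.queryLaw θ q).toReal * (P.recordLaw.map (P.answer j (q j)) a).toReal := by
  have : P.answerLaw θ j = (P.queryLaw θ).bind fun q => P.recordLaw.map (P.answer j (q j)) := by
    rw [queryLaw, PMF.bind_map]
    rfl
  rw [this, PMF.bind_apply, tsum_fintype, ENNReal.toReal_sum]
  · simp only [ENNReal.toReal_mul]
  · exact fun q _ => ENNReal.mul_ne_top (PMF.apply_ne_top _ _) (PMF.apply_ne_top _ _)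

theorem queryMean_negMulLog_le (θ : Fin M) (j : Fin N) (a : P.Answer j) :
    P.queryMean θ (fun q => Real.negMulLog (P.recordLaw.map (P.answer j (q j)) a).toReal)
      ≤ Real.negMulLog (P.answerLaw θ j a).toReal := by
  rw [toReal_answerLaw]
  exact Real.concaveOn_negMulLog.le_map_sum (fun _ _ => ENNReal.toReal_nonneg)
    (PMF.sum_toReal _) (fun _ _ => ENNReal.toReal_nonneg)

theorem queryMean_condEntropy_eq_sum (θ : Fin M) (j : Fin N) :
    P.queryMean θ (fun q => P.condEntropy q {j} ∅) = ∑ a, P.queryMean θ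
      (fun q => Real.negMulLog (P.recordLaw.map (P.answer j (q j)) a).toReal) := by
  rw [← queryMean_sum]
  simp only [condEntropy_singleton_empty]
  rfl

/-- The entropy of an answer is at least its entropy given the query. -/
theorem queryMean_condEntropy_singleton_le (θ : Fin M) (j : Fin N) :
    P.queryMean θ (fun q => P.condEntropy q {j} ∅) ≤ shannonEntropy (P.answerLaw θ j) := by
  rw [queryMean_condEntropy_eq_sum]
  exact Finset.sum_le_sum fun a _ => queryMean_negMulLog_le θ j a

/-- If the entropy of an answer is its mean entropy given the query, then, by strict concavity,
the answer is independent of the query, so that its entropy is the same for all queries. -/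
theorem condEntropy_eq_of_queryMean_eq {θ : Fin M} {j : Fin N}
    (h : P.queryMean θ (fun q => P.condEntropy q {j} ∅) = shannonEntropy (P.answerLaw θ j))
    {q : (j : Fin N) → P.Query j} (hq : q ∈ (P.queryLaw θ).support) :
    P.condEntropy q {j} ∅ = shannonEntropy (P.answerLaw θ j) := by
  rw [queryMean_condEntropy_eq_sum] at h
  rw [condEntropy_singleton_empty]
  refine Finset.sum_congr rfl fun a _ => congrArg _ ?_
  have ha := (Finset.sum_eq_sum_iff_of_le fun a _ => queryMean_negMulLog_le θ j a).1 h a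
    (Finset.mem_univ a)
  rw [toReal_answerLaw] at ha ⊢
  exact (Real.strictConcaveOn_negMulLog.map_sum_eq_iff' (fun _ _ => ENNReal.toReal_nonneg)
    (PMF.sum_toReal _) (fun _ _ => ENNReal.toReal_nonneg)).1 ha.symm q (Finset.mem_univ q)
    (toReal_queryLaw_pos hq).ne'

theorem condEntropy_univ_le_sum (q : (j : Fin N) → P.Query j) (K : Finset (Fin M)) :
    P.condEntropy q Finset.univ K ≤ ∑ j, P.condEntropy q {j} K := by
  have h := (isSubmodular_condEntropy q K).choose_mul_le le_rfl
  rw [Nat.sub_self, Nat.choose_zero_right, Nat.cast_one, one_mul, Finset.powersetCard_one,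
    Finset.sum_map] at h
  exact h

theorem queryMean_condEntropy_univ_le (θ : Fin M) :
    P.queryMean θ (fun q => P.condEntropy q Finset.univ ∅)
      ≤ ∑ j, P.queryMean θ (fun q => P.condEntropy q {j} ∅) := by
  rw [← queryMean_sum]
  exact queryMean_mono fun q _ => condEntropy_univ_le_sum q ∅

theorem queryMean_condEntropy_eq_of_private (hp : P.IsPrivate T) {Γ : Finset (Fin N)}
    (hΓ : Γ.card ≤ T) (θ θ' : Fin M) (K : Finset (Fin M)) :
    P.queryMean θ (fun q => P.condEntropy q Γ K) = P.queryMean θ' (fun q => P.condEntropy q Γ K) :=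
  queryMean_eq_of_private hp hΓ θ θ' fun _ _ h => condEntropy_congr h K

theorem mul_choose_pred (hT : 1 ≤ T) (hTN : T ≤ N) :
    (N * (N - 1).choose (T - 1) : ℝ) = T * N.choose T := by
  obtain ⟨T, rfl⟩ := Nat.exists_eq_add_of_le' hT
  obtain ⟨N, rfl⟩ := Nat.exists_eq_add_of_le' (hT.trans hTN)
  have := Nat.add_one_mul_choose_eq N T
  simp only [Nat.add_sub_cancel]
  rw [mul_comm ((T + 1 : ℕ) : ℝ)]
  exact_mod_cast this

/-- Privacy transfers the answers of any `T` servers from one wanted record to another, and Han's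
inequality bounds what `T` servers say by a `T / N`-part of what all servers say. -/
theorem ratio_mul_queryMean_le (hp : P.IsPrivate T) (hT : 1 ≤ T) (hTN : T < N) (θ θ' : Fin M)
    (K : Finset (Fin M)) :
    (T : ℝ) / N * P.queryMean θ' (fun q => P.condEntropy q Finset.univ K)
      ≤ P.queryMean θ (fun q => P.condEntropy q Finset.univ K) := by
  have h1 : (N - 1).choose (T - 1) * P.queryMean θ' (fun q => P.condEntropy q Finset.univ K)
      ≤ N.choose T * P.queryMean θ (fun q => P.condEntropy q Finset.univ K) := by
    calc _ ≤ P.queryMean θ' (fun q => ∑ Γ ∈ Finset.powersetCard T Finset.univ,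
          P.condEntropy q Γ K) := by
          rw [← queryMean_const_mul]
          exact queryMean_mono fun q _ => (isSubmodular_condEntropy q K).choose_mul_le hT
      _ = ∑ Γ ∈ Finset.powersetCard T (Finset.univ : Finset (Fin N)),
          P.queryMean θ (fun q => P.condEntropy q Γ K) := by
          rw [queryMean_sum]
          refine Finset.sum_congr rfl fun Γ hΓ => ?_
          exact queryMean_condEntropy_eq_of_private hp (Finset.mem_powersetCard.1 hΓ).2.le _ _ K
      _ ≤ ∑ Γ ∈ Finset.powersetCard T (Finset.univ : Finset (Fin N)),
          P.queryMean θ (fun q => P.condEntropy q Finset.univ K) :=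
          Finset.sum_le_sum fun Γ _ => queryMean_mono fun q _ =>
            condEntropy_mono q (Finset.subset_univ Γ) K
      _ = _ := by
          rw [Finset.sum_const, Finset.card_powersetCard, Finset.card_univ, Fintype.card_fin,
            nsmul_eq_mul]
  have hN : (0 : ℝ) < N := by exact_mod_cast (by omega : 0 < N)
  have hC : (0 : ℝ) < N.choose T := by exact_mod_cast Nat.choose_pos hTN.le
  have h2 := mul_choose_pred (N := N) hT hTN.le
  rw [div_mul_eq_mul_div, div_le_iff₀ hN]
  refine le_of_mul_le_mul_left ?_ hC
  calc _ = (N * (N - 1).choose (T - 1) : ℝ)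
        * P.queryMean θ' (fun q => P.condEntropy q Finset.univ K) := by rw [h2]; ring
    _ ≤ _ := by nlinarith

theorem queryMean_condEntropy_univ_eq_add (h : P.IsTPrivatePIR T) {θ : Fin M}
    {K : Finset (Fin M)} (hθ : θ ∉ K) :
    P.queryMean θ (fun q => P.condEntropy q Finset.univ K) = shannonEntropy (P.singleRecordLaw θ)
      + P.queryMean θ (fun q => P.condEntropy q Finset.univ (insert θ K)) := by
  rw [queryMean_congr fun q hq => condEntropy_univ_eq_add h.records h.correct hθ hq,
    queryMean_add, queryMean_const]

/-- By induction on the number of records that are not given. -/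
theorem downloadCost_mul_le_queryMean (h : P.IsTPrivatePIR T) (hT : 1 ≤ T) (hTN : T < N)
    {m : ℕ} {θ : Fin M} {K : Finset (Fin M)} (hθ : θ ∉ K) (hK : K.card + m = M) :
    shannonEntropy (P.singleRecordLaw θ) * downloadCost N T m
      ≤ P.queryMean θ (fun q => P.condEntropy q Finset.univ K) := by
  induction m generalizing θ K with
  | zero =>
    have : K = Finset.univ := by rwa [← Finset.card_eq_iff_eq_univ, Fintype.card_fin]
    exact absurd (this ▸ Finset.mem_univ θ) hθ
  | succ m ih =>
    rw [queryMean_condEntropy_univ_eq_add h hθ, downloadCost_succ, mul_add, mul_one]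
    refine add_le_add le_rfl ?_
    have hc := Finset.card_insert_of_notMem hθ
    by_cases hu : insert θ K = Finset.univ
    · have hm : m = 0 := by rw [hu, Finset.card_univ, Fintype.card_fin] at hc; omega
      simp [hm, hu, condEntropy_univ_right, queryMean_const, downloadCost]
    · obtain ⟨θ', hθ'⟩ : ∃ θ', θ' ∉ insert θ K := by
        by_contra! hall
        exact hu (Finset.eq_univ_of_forall hall)
      have h1 := ih hθ' (by omega)
      have h2 := ratio_mul_queryMean_le h.isPrivate hT hTN θ θ' (insert θ K)
      rw [h.records.2 θ' θ] at h1
      refine le_trans ?_ h2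
      rw [mul_left_comm]
      exact mul_le_mul_of_nonneg_left h1 (by positivity)

theorem downloadCost_mul_le_sum (h : P.IsTPrivatePIR T) (hT : 1 ≤ T) (hTN : T < N) (θ : Fin M) :
    shannonEntropy (P.singleRecordLaw θ) * downloadCost N T M
      ≤ ∑ j, shannonEntropy (P.answerLaw θ j) :=
  (downloadCost_mul_le_queryMean h hT hTN (Finset.notMem_empty θ) (by simp)).trans
    ((queryMean_condEntropy_univ_le θ).trans
      (Finset.sum_le_sum fun j _ => queryMean_condEntropy_singleton_le θ j))

/-- The converse: no scheme has a larger rate. -/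
theorem rate_le (h : P.IsTPrivatePIR T) (hT : 1 ≤ T) (hTN : T < N) (θ : Fin M) :
    P.rate θ ≤ 1 / downloadCost N T M := by
  have hM : M ≠ 0 := by have := θ.2; omega
  have hb := downloadCost_pos N T hM
  have hle := downloadCost_mul_le_sum h hT hTN θ
  have h0 : 0 ≤ ∑ j, shannonEntropy (P.answerLaw θ j) :=
    Finset.sum_nonneg fun j _ => shannonEntropy_nonneg _
  rw [rate]
  rcases h0.eq_or_lt with h0 | h0
  · rw [← h0, div_zero]
    positivity
  · rwa [div_le_div_iff₀ h0 hb, one_mul]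

theorem sum_shannonEntropy_answerLaw (h : P.HasRate (1 / downloadCost N T M)) (θ : Fin M) :
    ∑ j, shannonEntropy (P.answerLaw θ j)
      = shannonEntropy (P.singleRecordLaw θ) * downloadCost N T M := by
  have hM : M ≠ 0 := by have := θ.2; omega
  have hb := downloadCost_pos N T hM
  have hr := h θ
  rw [rate] at hr
  have h0 : ∑ j, shannonEntropy (P.answerLaw θ j) ≠ 0 := fun h0 => by
    rw [h0, div_zero] at hr
    exact (one_div_pos.2 hb).ne hr
  rw [div_eq_div_iff h0 hb.ne', one_mul] at hr
  exact hr.symm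

/-! ### Schemes that meet the converse bound -/

theorem condEntropy_singleton_empty_eq (h : P.IsTPrivatePIR T) (hT : 1 ≤ T) (hTN : T < N)
    (hR : P.HasRate (1 / downloadCost N T M)) {θ : Fin M} {q : (j : Fin N) → P.Query j}
    (hq : q ∈ (P.queryLaw θ).support) (j : Fin N) :
    P.condEntropy q {j} ∅ = shannonEntropy (P.answerLaw θ j) := by
  have h1 := downloadCost_mul_le_queryMean h hT hTN (Finset.notMem_empty θ) (m := M) (by simp)
  rw [← sum_shannonEntropy_answerLaw hR] at h1
  have h2 := h1.trans (queryMean_condEntropy_univ_le θ)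
  have h3 := (Finset.sum_eq_sum_iff_of_le fun j _ =>
    queryMean_condEntropy_singleton_le (P := P) θ j).1
      (le_antisymm (Finset.sum_le_sum fun j _ => queryMean_condEntropy_singleton_le θ j) h2) j
      (Finset.mem_univ j)
  exact condEntropy_eq_of_queryMean_eq h3 hq

/-- In a scheme meeting the bound, every step of the induction behind the bound is tight. -/
theorem queryMean_condEntropy_univ (h : P.IsTPrivatePIR T) (hT : 1 ≤ T) (hTN : T < N)
    (hR : P.HasRate (1 / downloadCost N T M)) {m : ℕ} {θ : Fin M} {K : Finset (Fin M)}
    (hθ : θ ∉ K) (hK : K.card + m = M) :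
    P.queryMean θ (fun q => P.condEntropy q Finset.univ K)
      = shannonEntropy (P.singleRecordLaw θ) * downloadCost N T m := by
  induction K using Finset.induction_on generalizing θ m with
  | empty =>
    refine le_antisymm ?_ (downloadCost_mul_le_queryMean h hT hTN hθ hK)
    obtain rfl : m = M := by simpa using hK
    rw [← sum_shannonEntropy_answerLaw hR]
    exact (queryMean_condEntropy_univ_le θ).trans
      (Finset.sum_le_sum fun j _ => queryMean_condEntropy_singleton_le θ j)
  | insert θ₀ K hθ₀ ih =>
    refine le_antisymm ?_ (downloadCost_mul_le_queryMean h hT hTN hθ hK)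
    rw [Finset.card_insert_of_notMem hθ₀] at hK
    have h1 := ih hθ₀ (m := m + 1) (by omega)
    rw [queryMean_condEntropy_univ_eq_add h hθ₀, downloadCost_succ, mul_add, mul_one] at h1
    have h2 := ratio_mul_queryMean_le h.isPrivate hT hTN θ₀ θ (insert θ₀ K)
    rw [h.records.2 θ θ₀]
    rw [add_left_cancel h1, mul_left_comm] at h2
    have hT' : (0 : ℝ) < T / N := div_pos (by exact_mod_cast hT)
      (by exact_mod_cast (by omega : 0 < N))
    exact le_of_mul_le_mul_left h2 hT'

theorem ratio_mul_queryMean_eq (h : P.IsTPrivatePIR T) (hT : 1 ≤ T) (hTN : T < N)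
    (hR : P.HasRate (1 / downloadCost N T M)) {θ θ' : Fin M} {K : Finset (Fin M)}
    (hθ : θ ∈ K) (hθ' : θ' ∉ K) :
    (T : ℝ) / N * P.queryMean θ' (fun q => P.condEntropy q Finset.univ K)
      = P.queryMean θ (fun q => P.condEntropy q Finset.univ K) := by
  have hcard : K.card ≤ M := by simpa using K.card_le_univ
  have h1 := queryMean_condEntropy_univ h hT hTN hR hθ' (m := M - K.card) (by omega)
  have hm := Finset.card_erase_of_mem hθ
  have hpos : 0 < K.card := Finset.card_pos.2 ⟨θ, hθ⟩
  have h2 := queryMean_condEntropy_univ h hT hTN hR (Finset.notMem_erase θ K)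
    (m := (M - K.card) + 1) (by omega)
  rw [queryMean_condEntropy_univ_eq_add h (Finset.notMem_erase θ K), Finset.insert_erase hθ,
    downloadCost_succ, mul_add, mul_one] at h2
  rw [h1, add_left_cancel h2, h.records.2 θ' θ]
  ring

/-- Tightness, pointwise: given the wanted record and others, any `T` servers say as much as all
servers; given only other records, the answers are independent over any `T` servers and over all
of them. -/
theorem condEntropy_of_hasRate (h : P.IsTPrivatePIR T) (hT : 1 ≤ T) (hTN : T < N)
    (hR : P.HasRate (1 / downloadCost N T M)) {θ θ' : Fin M} {K : Finset (Fin M)}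
    (hθ : θ ∈ K) (hθ' : θ' ∉ K) :
    (∀ q ∈ (P.queryLaw θ).support, ∀ Γ : Finset (Fin N), Γ.card = T →
      P.condEntropy q Γ K = P.condEntropy q Finset.univ K) ∧
    ∀ q ∈ (P.queryLaw θ').support,
      (∀ Γ : Finset (Fin N), Γ.card = T → P.condEntropy q Γ K = ∑ j ∈ Γ, P.condEntropy q {j} K) ∧
      P.condEntropy q Finset.univ K = ∑ j, P.condEntropy q {j} K := by
  set S := Finset.powersetCard T (Finset.univ : Finset (Fin N)) with hS
  have hmid : P.queryMean θ' (fun q => ∑ Γ ∈ S, P.condEntropy q Γ K)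
      = P.queryMean θ (fun q => ∑ Γ ∈ S, P.condEntropy q Γ K) := by
    rw [queryMean_sum, queryMean_sum]
    refine Finset.sum_congr rfl fun Γ hΓ => ?_
    exact queryMean_condEntropy_eq_of_private h.isPrivate (Finset.mem_powersetCard.1 hΓ).2.le _ _ K
  have hle1 : ∀ q, (N - 1).choose (T - 1) * P.condEntropy q Finset.univ K
      ≤ ∑ Γ ∈ S, P.condEntropy q Γ K := fun q =>
    (isSubmodular_condEntropy q K).choose_mul_le hT
  have hle2 : ∀ q, ∑ Γ ∈ S, P.condEntropy q Γ K ≤ ∑ Γ ∈ S, P.condEntropy q Finset.univ K :=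
    fun q => Finset.sum_le_sum fun Γ _ => condEntropy_mono q (Finset.subset_univ Γ) K
  have hends : P.queryMean θ' (fun q => (N - 1).choose (T - 1) * P.condEntropy q Finset.univ K)
      = P.queryMean θ (fun q => ∑ Γ ∈ S, P.condEntropy q Finset.univ K) := by
    simp only [Finset.sum_const, hS, Finset.card_powersetCard, Finset.card_univ, Fintype.card_fin,
      nsmul_eq_mul]
    have hN : (N : ℝ) ≠ 0 := by exact_mod_cast (by omega : N ≠ 0)
    rw [queryMean_const_mul, queryMean_const_mul, ← ratio_mul_queryMean_eq h hT hTN hR hθ hθ',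
      ← mul_assoc]
    congr 1
    rw [mul_div_assoc', eq_div_iff hN, mul_comm, mul_choose_pred hT hTN.le, mul_comm]
  have hm1 := queryMean_mono (θ := θ') fun q _ => hle1 q
  have hm2 := queryMean_mono (θ := θ) fun q _ => hle2 q
  refine ⟨fun q hq Γ hΓ => ?_, fun q hq => ?_⟩
  · have heq := eq_of_queryMean_eq hle2 (by linarith) hq
    exact (Finset.sum_eq_sum_iff_of_le fun Γ _ =>
      condEntropy_mono q (Finset.subset_univ Γ) K).1 heq Γ (by simp [hS, hΓ])
  · have heq := eq_of_queryMean_eq hle1 (by linarith) hq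
    exact (isSubmodular_condEntropy q K).additive_of_choose_mul_eq hT hTN heq

/-- For `T ≥ 2`, given some but not all records, each single answer carries the same entropy: any
two servers are covered by one set of `T` servers, whose view can be exchanged for that of a query
whose wanted record is among the given ones, and there the answers of any `T` servers determine
the others. -/
theorem condEntropy_singleton_of_hasRate (h : P.IsTPrivatePIR T) (hT : 2 ≤ T) (hTN : T < N)
    (hR : P.HasRate (1 / downloadCost N T M)) {m : ℕ} {K : Finset (Fin M)} (hm : m ≠ 0)
    (hK0 : K.Nonempty) (hK : K.card + m = M) (θ : Fin M) {q : (j : Fin N) → P.Query j}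
    (hq : q ∈ (P.queryLaw θ).support) (j : Fin N) :
    P.condEntropy q {j} K = shannonEntropy (P.singleRecordLaw θ) / N * downloadCost N T m := by
  have hT1 : 1 ≤ T := by omega
  have hN : (N : ℝ) ≠ 0 := by exact_mod_cast (by omega : N ≠ 0)
  have swap : ∀ {θ θ' : Fin M} {q : (j : Fin N) → P.Query j} {Γ : Finset (Fin N)},
      q ∈ (P.queryLaw θ).support → Γ.card = T → ∃ q' ∈ (P.queryLaw θ').support,
        (∀ K, P.condEntropy q' Γ K = P.condEntropy q Γ K) ∧
        ∀ K, ∀ j ∈ Γ, P.condEntropy q' {j} K = P.condEntropy q {j} K := by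
    intro θ θ' q Γ hq hΓ
    obtain ⟨q', hq', he⟩ := exists_mem_support_of_private h.isPrivate hΓ.le θ θ' hq
    exact ⟨q', hq', fun K => condEntropy_congr he K, fun K j hj =>
      condEntropy_congr (fun i hi => by rw [Finset.mem_singleton.1 hi]; exact he j hj) K⟩
  induction m generalizing K θ q j with
  | zero => exact absurd rfl hm
  | succ m ih =>
    obtain ⟨θ₀, hθ₀⟩ := hK0
    obtain ⟨θ₁, hθ₁⟩ : ∃ θ₁, θ₁ ∉ K := by
      by_contra! hall
      rw [Finset.eq_univ_of_forall hall, Finset.card_univ, Fintype.card_fin] at hK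
      omega
    have tight := condEntropy_of_hasRate h hT1 hTN hR hθ₀ hθ₁
    have exT : ∀ i j : Fin N, ∃ Γ : Finset (Fin N), Γ.card = T ∧ i ∈ Γ ∧ j ∈ Γ := by
      intro i j
      obtain ⟨Γ, hΓ, -, hc⟩ := Finset.exists_subsuperset_card_eq
        (Finset.subset_univ ({i, j} : Finset (Fin N))) (n := T) (Finset.card_le_two.trans hT)
        (by simpa using hTN.le)
      exact ⟨Γ, hc, hΓ (by simp), hΓ (by simp)⟩
    -- when the wanted record is among the given ones
    have const₀ : ∀ q ∈ (P.queryLaw θ₀).support, ∀ i j,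
        P.condEntropy q {i} K = P.condEntropy q {j} K := by
      intro q hq
      refine eq_of_sum_powersetCard_const hT1 hTN (r := P.condEntropy q Finset.univ K) ?_
      intro Γ hΓ
      obtain ⟨q', hq', e1, e2⟩ := swap (θ' := θ₁) hq hΓ
      rw [← tight.1 q hq Γ hΓ, ← e1, (tight.2 q' hq').1 Γ hΓ]
      exact Finset.sum_congr rfl fun j hj => (e2 K j hj).symm
    have const₁ : ∀ q ∈ (P.queryLaw θ₁).support, ∀ i j,
        P.condEntropy q {i} K = P.condEntropy q {j} K := by
      intro q hq i j
      obtain ⟨Γ, hΓ, hi, hj⟩ := exT i j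
      obtain ⟨q', hq', -, e2⟩ := swap (θ' := θ₀) hq hΓ
      rw [← e2 K i hi, ← e2 K j hj]
      exact const₀ q' hq' i j
    have val₁ : ∀ q ∈ (P.queryLaw θ₁).support, ∀ j, P.condEntropy q {j} K
        = shannonEntropy (P.singleRecordLaw θ) / N * downloadCost N T (m + 1) := by
      intro q hq j
      have h1 := (tight.2 q hq).2
      rw [Finset.sum_congr rfl fun i _ => const₁ q hq i j, Finset.sum_const, Finset.card_univ,
        Fintype.card_fin, nsmul_eq_mul, condEntropy_univ_eq_add h.records h.correct hθ₁ hq,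
        h.records.2 θ₁ θ] at h1
      have hc := Finset.card_insert_of_notMem hθ₁
      have h2 : P.condEntropy q Finset.univ (insert θ₁ K)
          = T * (shannonEntropy (P.singleRecordLaw θ) / N * downloadCost N T m) := by
        rcases Nat.eq_zero_or_pos m with rfl | hm0
        · have : insert θ₁ K = Finset.univ := by
            rw [← Finset.card_eq_iff_eq_univ, Fintype.card_fin]
            omega
          simp [this, condEntropy_univ_right, downloadCost]
        · obtain ⟨θ₂, hθ₂⟩ : ∃ θ₂, θ₂ ∉ insert θ₁ K := by
            by_contra! hall
            rw [Finset.eq_univ_of_forall hall, Finset.card_univ, Fintype.card_fin] at hc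
            omega
          have tight' := condEntropy_of_hasRate h hT1 hTN hR (Finset.mem_insert_self θ₁ K) hθ₂
          obtain ⟨Γ, hΓ, -⟩ := exT j j
          obtain ⟨q', hq', e1, -⟩ := swap (θ' := θ₂) hq hΓ
          rw [← tight'.1 q hq Γ hΓ, ← e1, (tight'.2 q' hq').1 Γ hΓ,
            Finset.sum_congr rfl fun i _ => ih hm0.ne' (Finset.insert_nonempty _ _) (by omega)
              θ₂ hq' i, Finset.sum_const, hΓ, nsmul_eq_mul, h.records.2 θ₂ θ]
      rw [h2] at h1
      rw [downloadCost_succ]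
      field_simp
      field_simp at h1
      linarith
    obtain ⟨Γ, hΓ, hj, -⟩ := exT j j
    obtain ⟨q', hq', -, e2⟩ := swap (θ' := θ₁) hq hΓ
    rw [← e2 K j hj]
    exact val₁ q' hq' j

end PIRScheme

/-! ### The lower bound on the sub-packetization of linear schemes -/

/-- The entropy of the partition of a finite vector space into the cosets of a subspace. -/
theorem partEntropy_uniform_of_submodule {F V : Type*} [Field F] [Fintype F] [AddCommGroup V]
    [Module F V] [Fintype V] (S : Submodule F V) {r : Setoid V}
    (hr : ∀ a b, r a b ↔ a - b ∈ S) :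
    partEntropy (fun _ : V => (Fintype.card V : ℝ)⁻¹) r
      = ((Module.finrank F V : ℝ) - Module.finrank F S) * Real.log (Fintype.card F) := by
  classical
  have hV : (Fintype.card V : ℝ) ≠ 0 := by exact_mod_cast Fintype.card_ne_zero
  have hS : (Fintype.card S : ℝ) ≠ 0 := by exact_mod_cast Fintype.card_ne_zero
  have hmass : ∀ a, classMass (fun _ : V => (Fintype.card V : ℝ)⁻¹) r a
      = Fintype.card S / Fintype.card V := by
    intro a
    rw [classMass, Finset.sum_const, nsmul_eq_mul, div_eq_mul_inv]
    congr 2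
    rw [← Fintype.card_coe]
    refine Fintype.card_congr ⟨fun b => ⟨a - b, (hr a b).1 (Finset.mem_filter.1 b.2).2⟩,
      fun s => ⟨a - s, by simp [hr]⟩, fun b => by simp, fun s => by simp⟩
  simp only [partEntropy, hmass, Finset.sum_const, Finset.card_univ, nsmul_eq_mul]
  rw [Real.log_div hS hV, mul_inv_cancel_left₀ hV, Module.card_eq_pow_finrank (K := F) (V := V),
    Module.card_eq_pow_finrank (K := F) (V := S)]
  push_cast
  rw [Real.log_pow, Real.log_pow]
  ring

namespace LinearPIRScheme

variable {F : Type} [Field F] {M N L : ℕ}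

/-- The answer of a server to a fixed query, as a linear function of the records. -/
def answerMap {γ : ℕ} (Q : Fin M → Matrix (Fin L) (Fin γ) F) :
    (Fin M → Fin L → F) →ₗ[F] Fin γ → F :=
  ∑ i, (Q i).vecMulLinear ∘ₗ LinearMap.proj i

theorem answerMap_apply {γ : ℕ} (Q : Fin M → Matrix (Fin L) (Fin γ) F) (w : Fin M → Fin L → F) :
    answerMap Q w = ∑ i, Matrix.vecMul (w i) (Q i) := by
  simp [answerMap]

variable [Fintype F] (S : LinearPIRScheme F M N L)

theorem recordProb_toPIRScheme : S.toPIRScheme.recordProb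
    = fun _ => (Fintype.card (Fin M → Fin L → F) : ℝ)⁻¹ := by
  funext w
  have : S.toPIRScheme.recordLaw w = (Fintype.card (Fin M → Fin L → F) : ENNReal)⁻¹ := by
    classical
    refine (PMF.uniformOfFintype_apply (α := Fin M → Fin L → F) w).trans ?_
    congr
  rw [PIRScheme.recordProb, this, ENNReal.toReal_inv, ENNReal.toReal_natCast]

theorem partEntropy_of_submodule (U : Submodule F (Fin M → Fin L → F))
    {r : Setoid (Fin M → S.toPIRScheme.Record)}
    (hr : ∀ a b : Fin M → Fin L → F, r a b ↔ a - b ∈ U) :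
    partEntropy S.toPIRScheme.recordProb r
      = ((Module.finrank F (Fin M → Fin L → F) : ℝ) - Module.finrank F U)
        * Real.log (Fintype.card F) := by
  rw [← partEntropy_uniform_of_submodule U hr, recordProb_toPIRScheme]
  exact congrArg (fun i => @partEntropy _ i _ _) (Subsingleton.elim _ _)

/-- The records that vanish on `K`. -/
def recordKernel (F : Type) [Field F] (L : ℕ) (K : Finset (Fin M)) :
    Submodule F (Fin M → Fin L → F) where
  carrier := {w | ∀ i ∈ K, w i = 0}
  add_mem' := fun ha hb i hi => by simp [ha i hi, hb i hi]
  zero_mem' := fun _ _ => rfl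
  smul_mem' := fun c a ha i hi => by simp [ha i hi]

/-- The records to which the servers in `Γ` answer zero. -/
def answerKernel (q : (j : Fin N) → S.toPIRScheme.Query j) (Γ : Finset (Fin N)) :
    Submodule F (Fin M → Fin L → F) where
  carrier := {w | ∀ j ∈ Γ, answerMap (q j) w = 0}
  add_mem' := fun ha hb j hj => by rw [map_add, ha j hj, hb j hj, add_zero]
  zero_mem' := fun _ _ => map_zero _
  smul_mem' := fun c a ha j hj => by rw [map_smul, ha j hj, smul_zero]

theorem recordPart_iff_sub_mem (K : Finset (Fin M)) (a b : Fin M → Fin L → F) :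
    S.toPIRScheme.recordPart K a b ↔ a - b ∈ recordKernel F L K :=
  forall₂_congr fun i _ => (sub_eq_zero (a := a i) (b := b i)).symm

theorem answerPart_iff_sub_mem (q : (j : Fin N) → S.toPIRScheme.Query j) (Γ : Finset (Fin N))
    (a b : Fin M → Fin L → F) :
    S.toPIRScheme.answerPart q Γ a b ↔ a - b ∈ S.answerKernel q Γ :=
  forall₂_congr fun j _ => by
    have h : ∀ w : Fin M → Fin L → F, answerMap (q j) w = S.toPIRScheme.answer j (q j) w :=
      answerMap_apply (q j)
    rw [map_sub, sub_eq_zero]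
    exact ⟨fun e => (h a).trans (e.trans (h b).symm), fun e => (h a).symm.trans (e.trans (h b))⟩

/-- In a linear scheme all conditional entropies given the queries are differences of dimensions:
integers, in units of the entropy of a field element. -/
theorem exists_condEntropy_eq_int_mul (q : (j : Fin N) → S.toPIRScheme.Query j)
    (Γ : Finset (Fin N)) (K : Finset (Fin M)) :
    ∃ k : ℤ, S.toPIRScheme.condEntropy q Γ K = k * Real.log (Fintype.card F) := by
  refine ⟨(Module.finrank F (recordKernel F L K) : ℤ)
    - Module.finrank F (S.answerKernel q Γ ⊓ recordKernel F L K : Submodule F _), ?_⟩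
  rw [PIRScheme.condEntropy, S.partEntropy_of_submodule (recordKernel F L K)
    (S.recordPart_iff_sub_mem K), S.partEntropy_of_submodule
    (S.answerKernel q Γ ⊓ recordKernel F L K) fun a b => ?_]
  · push_cast
    ring
  · exact and_congr (S.answerPart_iff_sub_mem q Γ a b) (S.recordPart_iff_sub_mem K a b)

theorem shannonEntropy_singleRecordLaw_toPIRScheme (i : Fin M) :
    shannonEntropy (S.toPIRScheme.singleRecordLaw i) = L * Real.log (Fintype.card F) := by
  rw [PIRScheme.shannonEntropy_singleRecordLaw, S.partEntropy_of_submodule (recordKernel F L {i})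
    (S.recordPart_iff_sub_mem {i})]
  have e : recordKernel F L {i} = LinearMap.ker (LinearMap.proj (R := F)
      (φ := fun _ : Fin M => Fin L → F) i) := by
    ext w
    simp [recordKernel]
  have h := LinearMap.finrank_range_add_finrank_ker (LinearMap.proj (R := F)
      (φ := fun _ : Fin M => Fin L → F) i)
  rw [LinearMap.range_eq_top.2 (Function.surjective_eval i), finrank_top, Module.finrank_fin_fun,
    ← e] at h
  rw [← h]
  push_cast
  ring

theorem independentEqualSizeRecords_toPIRScheme :
    S.toPIRScheme.IndependentEqualSizeRecords := by
  refine ⟨?_, fun i i' => ?_⟩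
  · rw [Finset.sum_congr rfl fun i _ => S.shannonEntropy_singleRecordLaw_toPIRScheme i,
      shannonEntropy_eq_partEntropy]
    refine (S.partEntropy_of_submodule ⊥ (r := ⊥) fun a b => ?_).trans ?_
    · rw [Submodule.mem_bot, sub_eq_zero]
      rfl
    · simp [Module.finrank_pi_fintype]
      ring
  · rw [shannonEntropy_singleRecordLaw_toPIRScheme, shannonEntropy_singleRecordLaw_toPIRScheme]

end LinearPIRScheme

/-- Clearing denominators in `k = y (1 + t / n + ⋯ + (t / n) ^ m)`. -/
theorem pow_dvd_of_eq_mul_downloadCost {n t m y : ℕ} (hn : n ≠ 0) (h : Nat.Coprime n t) {k : ℤ}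
    (hk : (k : ℝ) = y * downloadCost n t (m + 1)) : n ^ m ∣ y := by
  set G : ℕ := ∑ i ∈ Finset.range (m + 1), n ^ (m - i) * t ^ i with hG
  have hn' : (n : ℝ) ≠ 0 := by exact_mod_cast hn
  have e : (n : ℝ) ^ m * downloadCost n t (m + 1) = G := by
    rw [downloadCost, Finset.mul_sum, hG]
    push_cast
    refine Finset.sum_congr rfl fun i hi => ?_
    obtain ⟨c, rfl⟩ := Nat.exists_eq_add_of_le (Nat.lt_succ_iff.1 (Finset.mem_range.1 hi))
    rw [Nat.add_sub_cancel_left, div_pow, pow_add]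
    field_simp
  have hcop : Nat.Coprime (n ^ m) G := by
    rcases Nat.eq_zero_or_pos m with rfl | hm
    · simp
    have hdvd : n ∣ ∑ i ∈ Finset.range m, n ^ (m - i) * t ^ i :=
      Finset.dvd_sum fun i hi => Dvd.dvd.mul_right
        (dvd_pow_self n (Nat.sub_ne_zero_of_lt (Finset.mem_range.1 hi))) _
    obtain ⟨c, hc⟩ := hdvd
    rw [hG, Finset.sum_range_succ, hc, Nat.sub_self, pow_zero, one_mul]
    apply Nat.Coprime.pow_left
    rw [add_comm]
    exact (Nat.coprime_add_mul_left_right _ _ _).2 (h.pow_right m)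
  have h1 : (n ^ m : ℕ) * k = (y * G : ℕ) := by
    have : ((n ^ m : ℕ) : ℝ) * k = (y * G : ℕ) := by
      push_cast
      rw [hk, ← e]
      ring
    exact_mod_cast this
  have h2 : ((n ^ m : ℕ) : ℤ) ∣ (y * G : ℕ) := ⟨k, h1.symm⟩
  exact hcop.dvd_of_dvd_mul_right (Int.natCast_dvd_natCast.1 h2)

/-- The lower bound.  For `T = 1` the total download, and for `T ≥ 2` the dimension of one answer
given all records but one, and given one record only, are integers that force the divisibility. -/
theorem LinearPIRScheme.le_subpacketization {F : Type} [Field F] [Fintype F] {M N L T d n t : ℕ}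
    (S : LinearPIRScheme F M N L) (hM : 2 ≤ M) (hT : 1 ≤ T) (hTN : T < N) (hdN : N = d * n)
    (hdT : T = d * t) (hcop : Nat.Coprime n t) (h : S.toPIRScheme.IsTPrivatePIR T)
    (hR : S.toPIRScheme.HasRate (1 / downloadCost N T M)) : d * n ^ (M - 1) ≤ L := by
  have hd0 : d ≠ 0 := by rintro rfl; omega
  have hn0 : n ≠ 0 := by rintro rfl; omega
  have hlog : 0 < Real.log (Fintype.card F) :=
    Real.log_pos (by exact_mod_cast Fintype.one_lt_card)
  have hcost : ∀ m, downloadCost N T m = downloadCost n t m := by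
    intro m
    have hd' : (d : ℝ) ≠ 0 := by exact_mod_cast hd0
    unfold downloadCost
    rw [hdN, hdT]
    push_cast
    rw [mul_div_mul_left _ _ hd']
  set θ : Fin M := ⟨0, by omega⟩
  set j : Fin N := ⟨0, by omega⟩
  obtain ⟨q, hq⟩ := (S.toPIRScheme.queryLaw θ).support_nonempty
  have hL0 : 0 < L := by
    rw [Nat.pos_iff_ne_zero]
    rintro rfl
    have h0 := hR θ
    rw [PIRScheme.rate, S.shannonEntropy_singleRecordLaw_toPIRScheme, Nat.cast_zero, zero_mul,
      zero_div] at h0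
    exact (one_div_pos.2 (downloadCost_pos N T (by omega : M ≠ 0))).ne h0
  rcases hT.eq_or_lt with hT1 | hT2
  · have hd : d = 1 := Nat.eq_one_of_dvd_one ⟨t, hT1.trans hdT⟩
    choose k hk using fun j => S.exists_condEntropy_eq_int_mul q {j} ∅
    have hs := PIRScheme.sum_shannonEntropy_answerLaw hR θ
    rw [← Finset.sum_congr rfl fun j _ =>
      PIRScheme.condEntropy_singleton_empty_eq h hT hTN hR hq j,
      Finset.sum_congr rfl fun j _ => hk j, ← Finset.sum_mul,
      S.shannonEntropy_singleRecordLaw_toPIRScheme, mul_right_comm, hcost] at hs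
    obtain ⟨m, rfl⟩ : ∃ m, M = m + 1 := ⟨M - 1, by omega⟩
    rw [hd, one_mul, Nat.add_sub_cancel]
    exact Nat.le_of_dvd hL0 (pow_dvd_of_eq_mul_downloadCost hn0 hcop (k := ∑ j, k j)
      (by push_cast; exact mul_right_cancel₀ hlog.ne' hs))
  · obtain ⟨m, rfl⟩ : ∃ m, M = m + 2 := ⟨M - 2, by omega⟩
    have hN' : (N : ℝ) ≠ 0 := by exact_mod_cast (by omega : N ≠ 0)
    have key : ∀ c, c ≠ 0 → c < m + 2 → ∃ k : ℤ, (k : ℝ) = L / N * downloadCost n t c := by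
      intro c hc hcM
      obtain ⟨K, -, hK⟩ := Finset.exists_subset_card_eq (s := (Finset.univ : Finset (Fin (m + 2))))
        (n := m + 2 - c) (by simp)
      obtain ⟨k, hk⟩ := S.exists_condEntropy_eq_int_mul q {j} K
      refine ⟨k, mul_right_cancel₀ hlog.ne' ?_⟩
      rw [← hk, PIRScheme.condEntropy_singleton_of_hasRate h hT2 hTN hR hc
        (Finset.card_pos.1 (by omega)) (by omega) θ hq j,
        S.shannonEntropy_singleRecordLaw_toPIRScheme, hcost]
      ring
    obtain ⟨k₁, hk₁⟩ := key 1 one_ne_zero (by omega)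
    obtain ⟨k₂, hk₂⟩ := key (m + 1) (by omega) (by omega)
    rw [downloadCost, Finset.sum_range_one, pow_zero, mul_one, eq_div_iff hN'] at hk₁
    obtain ⟨x, rfl⟩ : ∃ x : ℕ, k₁ = x := Int.eq_ofNat_of_zero_le (by
      have : (0 : ℝ) ≤ k₁ := nonneg_of_mul_nonneg_left (hk₁ ▸ Nat.cast_nonneg L)
        (by exact_mod_cast (by omega : 0 < N))
      exact_mod_cast this)
    have hLx : x * N = L := by exact_mod_cast hk₁
    have hdvd : n ^ m ∣ x := pow_dvd_of_eq_mul_downloadCost hn0 hcop (k := k₂) (by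
      rw [hk₂, ← hLx]
      push_cast
      rw [mul_div_cancel_right₀ _ hN'])
    have hx0 : 0 < x := Nat.pos_of_ne_zero (by rintro rfl; omega)
    calc d * n ^ (m + 2 - 1) = n ^ m * N := by
          rw [hdN, Nat.add_sub_assoc (by norm_num), pow_succ]; ring
      _ ≤ x * N := Nat.mul_le_mul_right _ (Nat.le_of_dvd hx0 hdvd)
      _ = L := hLx

/-! ### Linear schemes from column designs -/

/-- Two linearly independent families with the same index set are related by an automorphism. -/
theorem LinearIndependent.exists_linearEquiv {K V ι : Type*} [Field K] [AddCommGroup V]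
    [Module K V] [FiniteDimensional K V] {v v' : ι → V} (hv : LinearIndependent K v)
    (hv' : LinearIndependent K v') : ∃ e : V ≃ₗ[K] V, ∀ i, e (v i) = v' i := by
  have apply_inl : ∀ {v : ι → V} (hv : LinearIndependent K v) (i : ι),
      Module.Basis.sumExtend hv (Sum.inl i) = v i := by
    intro v hv i
    simp only [Module.Basis.sumExtend, Module.Basis.reindex_apply, Module.Basis.extend_apply_self]
    rfl
  set b := Module.Basis.sumExtend hv
  set b' := Module.Basis.sumExtend hv'
  have : Finite (ι ⊕ Module.Basis.sumExtendIndex hv) := Module.Finite.finite_basis b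
  have : Finite (ι ⊕ Module.Basis.sumExtendIndex hv') := Module.Finite.finite_basis b'
  have : Finite ι := Finite.of_injective (Sum.inl : ι → ι ⊕ Module.Basis.sumExtendIndex hv)
    Sum.inl_injective
  have : Finite (Module.Basis.sumExtendIndex hv) :=
    Finite.of_injective (Sum.inr : _ → ι ⊕ Module.Basis.sumExtendIndex hv) Sum.inr_injective
  have : Finite (Module.Basis.sumExtendIndex hv') :=
    Finite.of_injective (Sum.inr : _ → ι ⊕ Module.Basis.sumExtendIndex hv') Sum.inr_injective
  have hc : Nonempty (Module.Basis.sumExtendIndex hv ≃ Module.Basis.sumExtendIndex hv') := by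
    rw [← Finite.card_eq]
    have h1 := Module.finrank_eq_nat_card_basis b
    have h2 := Module.finrank_eq_nat_card_basis b'
    rw [Nat.card_sum] at h1 h2
    omega
  refine ⟨b.equiv b' (Equiv.sumCongr (Equiv.refl ι) hc.some), fun i => ?_⟩
  rw [← apply_inl hv i, Module.Basis.equiv_apply]
  simpa using apply_inl hv' i

theorem LinearIndependent.exists_generalLinearGroup {F ι : Type*} [Field F] {L : ℕ}
    {v v' : ι → Fin L → F} (hv : LinearIndependent F v) (hv' : LinearIndependent F v') :
    ∃ U : Matrix.GeneralLinearGroup (Fin L) F, ∀ i, U.val.mulVec (v i) = v' i := by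
  obtain ⟨e, he⟩ := hv.exists_linearEquiv hv'
  refine ⟨⟨LinearMap.toMatrix' e.toLinearMap, LinearMap.toMatrix' e.symm.toLinearMap, ?_, ?_⟩,
    fun i => ?_⟩
  · rw [← LinearMap.toMatrix'_comp]
    simp
  · rw [← LinearMap.toMatrix'_comp]
    simp
  · rw [LinearMap.toMatrix'_mulVec]
    exact he i

theorem PMF.map_equiv_uniformOfFintype {α : Type*} [Fintype α] [Nonempty α] (e : α ≃ α) :
    (PMF.uniformOfFintype α).map e = PMF.uniformOfFintype α := by
  ext b
  rw [PMF.map_apply, tsum_eq_single (e.symm b)]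
  · simp
  · intro a ha
    rw [if_neg]
    rintro rfl
    simp at ha

/-- The fixed part of a linear `T`-private scheme.  Server `j` is asked for one symbol for each
element of `Col j`; if record `θ` is wanted, the part of record `i` in a symbol is, up to the random
change of basis of that record, its pairing with the given vector.  The vector is zero unless the
record is active in the symbol. -/
structure ColumnDesign (F : Type) [Field F] (M N L T : ℕ) where
  /-- the symbols asked from a server -/
  Col : Fin N → Type
  [colFintype : ∀ j, Fintype (Col j)]
  /-- the records that take part in a symbol -/
  Active : Fin M → (Σ j, Col j) → Prop
  /-- the vector of a symbol, for a wanted record and a record -/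
  vec : Fin M → Fin M → (Σ j, Col j) → Fin L → F
  vec_eq_zero : ∀ θ i x, ¬ Active i x → vec θ i x = 0
  linearIndependent : ∀ θ i (Γ : Finset (Fin N)), Γ.card ≤ T →
    LinearIndependent F fun x : {x : Σ j, Col j // x.1 ∈ Γ ∧ Active i x} => vec θ i x
  decode : ∀ θ (u : Fin M → Fin L → F), (∀ x, ∑ i, u i ⬝ᵥ vec θ i x = 0) → u θ = 0

attribute [instance] ColumnDesign.colFintype

namespace ColumnDesign

variable {F : Type} [Field F] {M N L T : ℕ} (D : ColumnDesign F M N L T)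

/-- The vectors of the symbols of a server, as the columns of a matrix. -/
noncomputable def matrix (θ : Fin M) (j : Fin N) (i : Fin M) :
    Matrix (Fin L) (Fin (Fintype.card (D.Col j))) F :=
  Matrix.of fun r c => D.vec θ i ⟨j, (Fintype.equivFin _).symm c⟩ r

/-- At any `T` servers, the vectors for two wanted records differ by changes of basis. -/
theorem exists_mul_matrix_eq (θ θ' : Fin M) {Γ : Finset (Fin N)} (hΓ : Γ.card ≤ T) :
    ∃ U : Fin M → Matrix.GeneralLinearGroup (Fin L) F,
      ∀ j ∈ Γ, ∀ i, (U i).val * D.matrix θ j i = D.matrix θ' j i := by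
  choose U hU using fun i => (D.linearIndependent θ i Γ hΓ).exists_generalLinearGroup
    (D.linearIndependent θ' i Γ hΓ)
  refine ⟨U, fun j hj i => ?_⟩
  ext r c
  have key : (U i).val.mulVec (D.vec θ i ⟨j, (Fintype.equivFin _).symm c⟩)
      = D.vec θ' i ⟨j, (Fintype.equivFin _).symm c⟩ := by
    by_cases ha : D.Active i ⟨j, (Fintype.equivFin _).symm c⟩
    · exact hU i ⟨_, hj, ha⟩
    · rw [D.vec_eq_zero θ i _ ha, D.vec_eq_zero θ' i _ ha, Matrix.mulVec_zero]
  exact congrFun key r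

variable [Fintype F]

open Classical in
/-- The linear scheme of a design: the user hides the design by an independent uniformly random
change of basis of each record. -/
noncomputable def toLinearPIRScheme : LinearPIRScheme F M N L where
  Seed := Fin M → Matrix.GeneralLinearGroup (Fin L) F
  seedLaw := PMF.uniformOfFintype _
  γ j := Fintype.card (D.Col j)
  query θ s j i := (s i).val * D.matrix θ j i

theorem isCorrect : D.toLinearPIRScheme.toPIRScheme.IsCorrect := by
  intro θ
  have key : ∀ (s : Fin M → Matrix.GeneralLinearGroup (Fin L) F) (w : Fin M → Fin L → F),
      (∀ j, LinearPIRScheme.answerMap (fun i => (s i).val * D.matrix θ j i) w = 0) → w θ = 0 := by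
    intro s w h
    have hu := D.decode θ (fun i => Matrix.vecMul (w i) (s i).val) fun x => by
      obtain ⟨j, x⟩ := x
      have hx := congrFun (h j) (Fintype.equivFin _ x)
      rw [LinearPIRScheme.answerMap_apply, Finset.sum_apply] at hx
      refine (Finset.sum_congr rfl fun i _ => ?_).trans hx
      rw [← Matrix.vecMul_vecMul]
      simp [Matrix.vecMul, matrix]
    have := congrArg (fun y => Matrix.vecMul y (s θ)⁻¹.val) hu
    simpa [Matrix.vecMul_vecMul] using this
  have key2 : ∀ (s : Fin M → Matrix.GeneralLinearGroup (Fin L) F) (w w' : Fin M → Fin L → F),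
      (∀ j, LinearPIRScheme.answerMap (fun i => (s i).val * D.matrix θ j i) w
        = LinearPIRScheme.answerMap (fun i => (s i).val * D.matrix θ j i) w') → w θ = w' θ := by
    intro s w w' h
    refine sub_eq_zero.1 (key s (w - w') fun j => ?_)
    rw [map_sub, h j, sub_self]
  set P := D.toLinearPIRScheme.toPIRScheme
  have hfac : ∀ s : P.Seed, Function.FactorsThrough (fun w : Fin M → P.Record => w θ)
      fun w j => P.answer j (P.query θ s j) w := by
    intro s w w' h
    refine key2 s w w' fun j => ?_
    exact (LinearPIRScheme.answerMap_apply _ _).trans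
      ((congrFun h j).trans (LinearPIRScheme.answerMap_apply _ _).symm)
  exact ⟨fun s => Function.extend (fun w j => P.answer j (P.query θ s j) w) (fun w => w θ)
    fun _ => (0 : Fin L → F), fun s _ w _ => (hfac s).extend_apply _ w⟩

theorem isPrivate : D.toLinearPIRScheme.toPIRScheme.IsPrivate T := by
  intro Γ hΓ θ θ'
  set P := D.toLinearPIRScheme.toPIRScheme with hP
  have hview : ∀ θ, P.viewLaw θ Γ = (P.seedLaw.map fun s (j : Γ) => P.query θ s j).bind fun q =>
      P.recordLaw.map fun w => (q, fun j : Γ => P.answer j (q j) w, w) := by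
    intro θ
    rw [PMF.bind_map]
    rfl
  obtain ⟨U, hU⟩ := D.exists_mul_matrix_eq θ θ' hΓ
  rw [hview θ, hview θ']
  congr 1
  classical
  let e : P.Seed ≃ P.Seed := (Equiv.mulRight U : _ ≃ (Fin M → Matrix.GeneralLinearGroup (Fin L) F))
  have hq : (fun (s : P.Seed) (j : Γ) => P.query θ' s j)
      = (fun (s : P.Seed) (j : Γ) => P.query θ s j) ∘ e := by
    funext s j
    refine funext fun i => ?_
    change (s i).val * D.matrix θ' j i = ((s i).val * (U i).val) * D.matrix θ j i
    rw [← hU j j.2 i, Matrix.mul_assoc]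
  have he : P.seedLaw.map e = P.seedLaw := PMF.map_equiv_uniformOfFintype
    (α := Fin M → Matrix.GeneralLinearGroup (Fin L) F) _
  rw [hq, ← PMF.map_comp, he]

theorem isTPrivatePIR : D.toLinearPIRScheme.toPIRScheme.IsTPrivatePIR T :=
  ⟨D.toLinearPIRScheme.independentEqualSizeRecords_toPIRScheme, D.isCorrect, D.isPrivate⟩

/-- If the number of symbols is the one in the converse bound, the scheme meets the bound, because
the entropy of an answer is at most the logarithm of the number of its values. -/
theorem hasRate (hT : 1 ≤ T) (hTN : T < N) (hL : L ≠ 0)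
    (hcol : (∑ j, Fintype.card (D.Col j) : ℕ) = L * downloadCost N T M) :
    D.toLinearPIRScheme.toPIRScheme.HasRate (1 / downloadCost N T M) := by
  intro θ
  have hM : M ≠ 0 := by have := θ.2; omega
  have hb := downloadCost_pos N T hM
  have hlog : 0 < Real.log (Fintype.card F) :=
    Real.log_pos (by exact_mod_cast Fintype.one_lt_card)
  have hL' : (0 : ℝ) < L := by exact_mod_cast Nat.pos_of_ne_zero hL
  refine le_antisymm (PIRScheme.rate_le D.isTPrivatePIR hT hTN θ) ?_
  have hlow := PIRScheme.downloadCost_mul_le_sum D.isTPrivatePIR hT hTN θ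
  have hup : ∑ j, shannonEntropy (D.toLinearPIRScheme.toPIRScheme.answerLaw θ j)
      ≤ L * Real.log (Fintype.card F) * downloadCost N T M := by
    rw [mul_right_comm, ← hcol, Nat.cast_sum, Finset.sum_mul]
    refine Finset.sum_le_sum fun j _ => (shannonEntropy_le_log_card _).trans (le_of_eq ?_)
    have : Fintype.card (D.toLinearPIRScheme.toPIRScheme.Answer j)
        = Fintype.card F ^ Fintype.card (D.Col j) := by
      refine (Fintype.card_congr (Equiv.refl (Fin (Fintype.card (D.Col j)) → F))).trans ?_
      simp
    rw [this, Nat.cast_pow, Real.log_pow]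
  rw [PIRScheme.rate]
  rw [LinearPIRScheme.shannonEntropy_singleRecordLaw_toPIRScheme] at hlow ⊢
  have hpos : 0 < L * Real.log (Fintype.card F) * downloadCost N T M := by positivity
  rw [div_le_div_iff₀ hb (hpos.trans_le hlow), one_mul]
  exact hup

end ColumnDesign

/-! ### The number of symbols of each type at each server -/

/-- The number of coordinates at each server of the interference from a fixed set of `k + 1`
unwanted records.  Here and below `s` and `t` stand for `n - t` and `t`, and `m + 2` is the number of
records. -/
def blockSize (s t m k : ℕ) : ℕ := s ^ k * t ^ (m - k)

/-- The number of sums of parts of `k + 1` records that server `j` is asked for.  The sum over all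
servers is prescribed, and so is the sum of two consecutive values; alternating the direction of
the rounding achieves both. -/
def symbolCount (s t m k j : ℕ) : ℕ :=
  if Even k then (s ^ k * t ^ (m + 1 - k) + j % (s + t)) / (s + t)
  else (s ^ k * t ^ (m + 1 - k) + (s + t - 1 - j % (s + t))) / (s + t)

/-- The number of sums of parts of exactly the records in `K` that server `j` is asked for;
there are none for the empty set. -/
def typeCount (s t m : ℕ) {M : ℕ} (K : Finset (Fin M)) (j : ℕ) : ℕ :=
  if K = ∅ then 0 else symbolCount s t m (K.card - 1) j

theorem Nat.add_div_add_add_div_of_add_eq {a b c n r : ℕ} (h : a + b = n * c) (hr : r < n) :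
    (a + r) / n + (b + (n - 1 - r)) / n = c := by
  have hn : 0 < n := by omega
  set x := (a + r) / n with hx
  have h1 : n * x ≤ a + r := Nat.mul_div_le _ _
  have h2 : a + r < n * (x + 1) := by
    rw [mul_comm]
    exact (Nat.div_lt_iff_lt_mul hn).1 (Nat.lt_succ_self _)
  have hxc : x ≤ c := by
    by_contra! hlt
    have := Nat.mul_le_mul_left n (Nat.succ_le_of_lt hlt)
    rw [Nat.mul_succ] at this
    omega
  obtain ⟨y, rfl⟩ := Nat.exists_eq_add_of_le hxc
  have : (b + (n - 1 - r)) / n = y := by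
    rw [mul_add] at h
    rw [mul_add, mul_one] at h2
    apply Nat.div_eq_of_lt_le
    · rw [mul_comm]
      omega
    · rw [Nat.succ_mul, mul_comm]
      omega
  rw [this]

theorem symbolCount_add_succ {s t m k : ℕ} (hst : 0 < s + t) (hk : k ≤ m) (j : ℕ) :
    symbolCount s t m k j + symbolCount s t m (k + 1) j = blockSize s t m k := by
  have h : s ^ k * t ^ (m + 1 - k) + s ^ (k + 1) * t ^ (m + 1 - (k + 1))
      = (s + t) * blockSize s t m k := by
    rw [blockSize, Nat.add_sub_add_right, (by omega : m + 1 - k = m - k + 1)]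
    ring
  have hr : j % (s + t) < s + t := Nat.mod_lt _ hst
  rcases Nat.even_or_odd k with he | ho
  · have ho' : ¬ Even (k + 1) := by simpa using he.add_one
    rw [symbolCount, symbolCount, if_pos he, if_neg ho']
    exact Nat.add_div_add_add_div_of_add_eq h hr
  · have he' : Even (k + 1) := ho.add_one
    rw [symbolCount, symbolCount, if_neg (Nat.not_even_iff_odd.2 ho), if_pos he', add_comm]
    exact Nat.add_div_add_add_div_of_add_eq ((add_comm _ _).trans h) hr

/-- Hermite's identity. -/
theorem Nat.sum_range_add_div {n : ℕ} (hn : 0 < n) (a : ℕ) :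
    ∑ r ∈ Finset.range n, (a + r) / n = a := by
  induction a with
  | zero =>
    refine Finset.sum_eq_zero fun r hr => ?_
    rw [zero_add, Nat.div_eq_of_lt (Finset.mem_range.1 hr)]
  | succ a ih =>
    have h := Finset.sum_range_succ' (fun r => (a + r) / n) n
    rw [Finset.sum_range_succ, ih, Nat.add_div_right a hn, add_zero] at h
    have e : ∑ r ∈ Finset.range n, (a + 1 + r) / n = ∑ r ∈ Finset.range n, (a + (r + 1)) / n :=
      Finset.sum_congr rfl fun r _ => by rw [add_assoc, add_comm 1 r]
    omega

theorem Nat.sum_fin_mul_mod (d n : ℕ) (f : ℕ → ℕ) :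
    ∑ j : Fin (d * n), f (j.val % n) = d * ∑ r ∈ Finset.range n, f r := by
  rw [Fin.sum_univ_eq_sum_range fun j => f (j % n)]
  induction d with
  | zero => simp
  | succ d ih =>
    rw [Nat.succ_mul, Finset.sum_range_add, ih, Nat.succ_mul]
    congr 1
    refine Finset.sum_congr rfl fun r hr => ?_
    rw [mul_comm d n, Nat.mul_add_mod, Nat.mod_eq_of_lt (Finset.mem_range.1 hr)]

theorem sum_symbolCount {s t m k : ℕ} (hst : 0 < s + t) (d : ℕ) :
    ∑ j : Fin (d * (s + t)), symbolCount s t m k j = d * (s ^ k * t ^ (m + 1 - k)) := by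
  unfold symbolCount
  split_ifs
  · rw [Nat.sum_fin_mul_mod d (s + t) fun r => (s ^ k * t ^ (m + 1 - k) + r) / (s + t),
      Nat.sum_range_add_div hst]
  · rw [Nat.sum_fin_mul_mod d (s + t)
      fun r => (s ^ k * t ^ (m + 1 - k) + (s + t - 1 - r)) / (s + t),
      Finset.sum_range_reflect fun r => (s ^ k * t ^ (m + 1 - k) + r) / (s + t),
      Nat.sum_range_add_div hst]

theorem sum_typeCount {s t m M : ℕ} (hst : 0 < s + t) (d : ℕ) {K : Finset (Fin M)}
    (hK : K ≠ ∅) : ∑ j : Fin (d * (s + t)), typeCount s t m K j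
      = d * (s ^ (K.card - 1) * t ^ (m + 1 - (K.card - 1))) := by
  simp only [typeCount, if_neg hK]
  exact sum_symbolCount hst d

theorem typeCount_add_insert {s t m : ℕ} (hst : 0 < s + t) {K : Finset (Fin (m + 2))}
    {θ : Fin (m + 2)} (hK : K.Nonempty) (hθ : θ ∉ K) (j : ℕ) :
    typeCount s t m K j + typeCount s t m (insert θ K) j = blockSize s t m (K.card - 1) := by
  have h0 := hK.card_pos
  have h1 := Finset.card_insert_of_notMem hθ
  have h2 : (insert θ K).card ≤ m + 2 := by simpa using (insert θ K).card_le_univ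
  rw [typeCount, typeCount, if_neg hK.ne_empty, if_neg (Finset.insert_ne_empty θ K), h1,
    Nat.add_sub_cancel, ← symbolCount_add_succ hst (by omega : K.card - 1 ≤ m) j,
    Nat.sub_add_cancel h0]

/-- The number of symbols that involve the record `θ` is the sub-packetization. -/
theorem sum_typeCount_mem {s t m : ℕ} (hst : 0 < s + t) (d : ℕ) (θ : Fin (m + 2)) :
    ∑ j : Fin (d * (s + t)), ∑ K : Finset (Fin (m + 2)), (if θ ∈ K then typeCount s t m K j else 0)
      = d * (s + t) ^ (m + 1) := by
  rw [Finset.sum_comm]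
  have hu : (Finset.univ : Finset (Finset (Fin (m + 2))))
      = (insert θ (Finset.univ.erase θ)).powerset := by
    rw [Finset.insert_erase (Finset.mem_univ θ), Finset.powerset_univ]
  have hc : (Finset.univ.erase θ).card = m + 1 := by simp
  rw [hu, Finset.sum_powerset_insert (Finset.notMem_erase θ _), Finset.sum_eq_zero, zero_add,
    ← hc, ← Finset.sum_pow_mul_eq_add_pow, Finset.mul_sum]
  · refine Finset.sum_congr rfl fun K hK => ?_
    have hθ : θ ∉ K := fun h => Finset.notMem_erase θ _ (Finset.mem_powerset.1 hK h)
    simp only [Finset.mem_insert_self, if_true]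
    rw [sum_typeCount hst d (Finset.insert_ne_empty θ K), Finset.card_insert_of_notMem hθ,
      Nat.add_sub_cancel, hc]
  · intro K hK
    have hθ : θ ∉ K := fun h => Finset.notMem_erase θ _ (Finset.mem_powerset.1 hK h)
    simp [hθ]

/-- The total number of symbols is the download `d (n ^ M - t ^ M) / (n - t)`, where `n = s + t` and
`M = m + 2`. -/
theorem mul_sum_typeCount {s t m : ℕ} (hst : 0 < s + t) (d : ℕ) :
    s * (∑ j : Fin (d * (s + t)), ∑ K : Finset (Fin (m + 2)), typeCount s t m K j)
      + d * t ^ (m + 2) = d * (s + t) ^ (m + 2) := by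
  have h := Fintype.sum_pow_mul_eq_add_pow (Fin (m + 2)) s t
  rw [Fintype.card_fin] at h
  rw [Finset.sum_comm, ← h, Finset.mul_sum, Finset.mul_sum,
    ← Finset.sum_erase_add _ _ (Finset.mem_univ (∅ : Finset (Fin (m + 2)))),
    ← Finset.sum_erase_add _ _ (Finset.mem_univ (∅ : Finset (Fin (m + 2))))]
  simp only [typeCount, if_true, Finset.sum_const_zero, mul_zero, add_zero, Finset.card_empty,
    pow_zero, one_mul, Nat.sub_zero]
  congr 1
  refine Finset.sum_congr rfl fun K hK => ?_
  have hK' := Finset.ne_of_mem_erase hK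
  have h0 : 0 < K.card := Finset.card_pos.2 (Finset.nonempty_iff_ne_empty.2 hK')
  have h1 : K.card ≤ m + 2 := by simpa using K.card_le_univ
  simp only [if_neg hK']
  rw [sum_symbolCount hst d]
  obtain ⟨k, hk⟩ := Nat.exists_eq_succ_of_ne_zero h0.ne'
  rw [hk, Nat.succ_sub_one, Nat.succ_eq_add_one, pow_succ, (by omega : m + 2 - (k + 1) = m + 1 - k)]
  ring

/-- The coordinates of an unwanted record `i` suffice for the interference of all sets of unwanted
records that contain `i`. -/
theorem sum_interferenceDim_le {s t m : ℕ} (d : ℕ) {θ i : Fin (m + 2)} (hi : i ≠ θ) :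
    ∑ K : Finset (Fin (m + 2)) with i ∈ K ∧ θ ∉ K, d * t * blockSize s t m (K.card - 1)
      ≤ d * (s + t) ^ (m + 1) := by
  set B := (Finset.univ.erase θ).erase i with hB
  have hc : B.card = m := by
    rw [hB, Finset.card_erase_of_mem (by simp [hi])]
    simp
  have hiB : i ∉ B := Finset.notMem_erase i _
  have hset : (Finset.univ.filter fun K : Finset (Fin (m + 2)) => i ∈ K ∧ θ ∉ K)
      = (insert i B).powerset.filter fun K => i ∈ K := by
    ext K
    rw [hB, Finset.insert_erase (by simp [hi])]
    simp only [Finset.mem_filter, Finset.mem_univ, true_and, Finset.mem_powerset,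
      Finset.subset_erase, Finset.subset_univ]
    exact and_comm
  rw [hset, Finset.sum_filter, Finset.sum_powerset_insert hiB, Finset.sum_eq_zero, zero_add]
  · have : ∀ K ∈ B.powerset, (if i ∈ insert i K then
        d * t * blockSize s t m ((insert i K).card - 1) else 0)
        = d * t * (s ^ K.card * t ^ (B.card - K.card)) := by
      intro K hK
      rw [if_pos (Finset.mem_insert_self i K), Finset.card_insert_of_notMem
        fun h => hiB (Finset.mem_powerset.1 hK h), Nat.add_sub_cancel, blockSize, hc]
    rw [Finset.sum_congr rfl this, ← Finset.mul_sum, Finset.sum_pow_mul_eq_add_pow, hc, pow_succ,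
      mul_assoc, mul_comm ((s + t) ^ m)]
    gcongr
    omega
  · intro K hK
    rw [if_neg fun h => hiB (Finset.mem_powerset.1 hK h)]

/-! ### A column design with optimal sub-packetization -/

theorem exists_injOn_of_card_le {α β : Type*} [Fintype β] [Nonempty β] {B : Finset α}
    (h : B.card ≤ Fintype.card β) : ∃ f : α → β, Set.InjOn f B := by
  obtain ⟨e⟩ := Function.Embedding.nonempty_of_card_le (α := B) (β := β) (by simpa using h)
  refine ⟨Function.extend Subtype.val e fun _ => Classical.arbitrary β, fun a ha b hb hab => ?_⟩
  have key : ∀ a : B, Function.extend Subtype.val e (fun _ => Classical.arbitrary β) a.val = e a :=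
    fun a => Subtype.val_injective.extend_apply _ _ a
  rw [key ⟨a, ha⟩, key ⟨b, hb⟩] at hab
  exact congrArg Subtype.val (e.injective hab)

theorem linearIndependent_of_exists_functional {F V ι : Type*} [Field F] [AddCommGroup V]
    [Module F V] {v : ι → V}
    (h : ∀ i, ∃ φ : V →ₗ[F] F, φ (v i) ≠ 0 ∧ ∀ j, j ≠ i → φ (v j) = 0) :
    LinearIndependent F v := by
  rw [linearIndependent_iff']
  intro s g hg i hi
  obtain ⟨φ, h1, h2⟩ := h i
  have := congrArg φ hg
  rw [map_sum, map_zero, Finset.sum_eq_single i, map_smul, smul_eq_mul] at this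
  · exact (mul_eq_zero.1 this).resolve_right h1
  · intro j _ hj
    rw [map_smul, h2 j hj, smul_zero]
  · exact fun h => absurd hi h

section Vandermonde

variable {F : Type*} [Field F]

/-- The vector of the powers of `x` below `D`, placed at the given coordinates. -/
def vandermondeVec {L : ℕ} (D : ℕ) (emb : ℕ → Fin L) (x : F) : Fin L → F :=
  ∑ e : Fin D, Pi.single (emb e) (x ^ (e : ℕ))

theorem dotProduct_vandermondeVec {L : ℕ} (D : ℕ) (emb : ℕ → Fin L) (x : F) (u : Fin L → F) :
    u ⬝ᵥ vandermondeVec D emb x = ∑ e : Fin D, u (emb e) * x ^ (e : ℕ) := by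
  simp [vandermondeVec, dotProduct_sum]

/-- A combination of powers below `D` that vanishes at `D` points vanishes. -/
theorem sum_mul_pow_eq_zero {ι : Type*} {D : ℕ} (a : Fin D → F) {S : Finset ι} {v : ι → F}
    (hv : Set.InjOn v S) (hS : D ≤ S.card) (h : ∀ i ∈ S, ∑ e, a e * v i ^ (e : ℕ) = 0) (x : F) :
    ∑ e, a e * x ^ (e : ℕ) = 0 := by
  have hev : ∀ y : F, (∑ e, Polynomial.C (a e) * Polynomial.X ^ (e : ℕ)).eval y
      = ∑ e, a e * y ^ (e : ℕ) := fun y => by simp [Polynomial.eval_finsetSum]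
  have h0 : ∑ e, Polynomial.C (a e) * Polynomial.X ^ (e : ℕ) = 0 :=
    Polynomial.eq_zero_of_degree_lt_of_eval_index_eq_zero (s := S) (v := v) hv
      ((Polynomial.degree_sum_fin_lt a).trans_le (by exact_mod_cast hS))
      fun i hi => (hev _).trans (h i hi)
  rw [← hev, h0, Polynomial.eval_zero]

end Vandermonde

section Design

variable (d s t m : ℕ)

/-- The symbols asked from the servers: a server, a set of records, and a counter. -/
abbrev PIRSymbol : Type :=
  Σ j : Fin (d * (s + t)), Σ K : Finset (Fin (m + 2)), Fin (typeCount s t m K j)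

variable {d s t m}

/-- The position of a symbol within the interference that it carries when `θ` is wanted: that of the
set `K` of its records if `θ ∉ K`, and that of `K \ {θ}` otherwise. -/
def symbolPosition (θ : Fin (m + 2)) (x : PIRSymbol d s t m) : ℕ :=
  if θ ∈ x.2.1 then typeCount s t m (x.2.1.erase θ) x.1 + x.2.2 else x.2.2

theorem PIRSymbol.ext_of_eq {x y : PIRSymbol d s t m} (h1 : x.1 = y.1) (h2 : x.2.1 = y.2.1)
    (h3 : (x.2.2 : ℕ) = y.2.2) : x = y := by
  obtain ⟨j, K, c⟩ := x
  obtain ⟨j', K', c'⟩ := y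
  obtain rfl : j = j' := h1
  obtain rfl : K = K' := h2
  obtain rfl : c = c' := Fin.ext h3
  rfl

theorem eq_of_symbolPosition_eq {θ : Fin (m + 2)} {x y : PIRSymbol d s t m} (h1 : x.1 = y.1)
    (h2 : x.2.1.erase θ = y.2.1.erase θ) (h3 : symbolPosition θ x = symbolPosition θ y) :
    x = y := by
  have aux : ∀ {x y : PIRSymbol d s t m}, x.1 = y.1 → x.2.1.erase θ = y.2.1.erase θ →
      symbolPosition θ x = symbolPosition θ y → θ ∈ x.2.1 → θ ∈ y.2.1 := by
    intro x y h1 h2 h3 hx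
    by_contra hy
    rw [symbolPosition, symbolPosition, if_pos hx, if_neg hy, h2, Finset.erase_eq_of_notMem hy]
      at h3
    have h4 : typeCount s t m y.2.1 x.1 = typeCount s t m y.2.1 y.1 := by rw [h1]
    have := y.2.2.2
    omega
  by_cases hx : θ ∈ x.2.1
  · have hy := aux h1 h2 h3 hx
    rw [symbolPosition, symbolPosition, if_pos hx, if_pos hy, h2] at h3
    have h4 : typeCount s t m (y.2.1.erase θ) x.1 = typeCount s t m (y.2.1.erase θ) y.1 := by
      rw [h1]
    refine PIRSymbol.ext_of_eq h1 ?_ (by omega)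
    rw [← Finset.insert_erase hx, h2, Finset.insert_erase hy]
  · have hy : θ ∉ y.2.1 := fun hy => hx (aux h1.symm h2.symm h3.symm hy)
    rw [symbolPosition, symbolPosition, if_neg hx, if_neg hy] at h3
    rw [Finset.erase_eq_of_notMem hx, Finset.erase_eq_of_notMem hy] at h2
    exact PIRSymbol.ext_of_eq h1 h2 h3

theorem symbolPosition_lt (hst : 0 < s + t) {θ i : Fin (m + 2)} (hi : i ≠ θ)
    {x : PIRSymbol d s t m} (hx : i ∈ x.2.1) :
    symbolPosition θ x < blockSize s t m ((x.2.1.erase θ).card - 1) := by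
  have hne : (x.2.1.erase θ).Nonempty := ⟨i, Finset.mem_erase.2 ⟨hi, hx⟩⟩
  have h := typeCount_add_insert hst hne (Finset.notMem_erase θ x.2.1) x.1
  have hc := x.2.2.2
  by_cases hθ : θ ∈ x.2.1
  · rw [Finset.insert_erase hθ] at h
    rw [symbolPosition, if_pos hθ]
    omega
  · rw [symbolPosition, if_neg hθ]
    rw [Finset.erase_eq_of_notMem hθ] at h ⊢
    omega

variable {F : Type} [Field F] {L : ℕ}

/-- The vector of a symbol.  The parts of the wanted record are distinct basis vectors; the parts of
an unwanted record `i` in the symbols that carry the interference of a set `K` are vectors of a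
Vandermonde code of dimension `d t` times the block size, in the coordinates set aside for `K`. -/
def designVec (row : Fin (m + 2) → PIRSymbol d s t m → Fin L)
    (emb : Fin (m + 2) → Fin (m + 2) → (Σ _ : Finset (Fin (m + 2)), ℕ) → Fin L)
    (pt : ℕ → Fin (d * (s + t)) × ℕ → F) (θ i : Fin (m + 2)) (x : PIRSymbol d s t m) :
    Fin L → F :=
  if i ∈ x.2.1 then
    if i = θ then Pi.single (row θ x) 1
    else vandermondeVec (d * t * blockSize s t m ((x.2.1.erase θ).card - 1))
      (fun e => emb θ i ⟨x.2.1.erase θ, e⟩)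
      (pt ((x.2.1.erase θ).card - 1) (x.1, symbolPosition θ x))
  else 0

variable {row : Fin (m + 2) → PIRSymbol d s t m → Fin L}
  {emb : Fin (m + 2) → Fin (m + 2) → (Σ _ : Finset (Fin (m + 2)), ℕ) → Fin L}
  {pt : ℕ → Fin (d * (s + t)) × ℕ → F}

/-- The symbols of type `K ∌ θ` determine the interference of `K`, which can then be removed from the
symbols of type `K ∪ {θ}`. -/
theorem eq_zero_of_dotProduct_designVec (hst : 0 < s + t)
    (hpt : ∀ k ≤ m, Set.InjOn (pt k)
      (Finset.univ ×ˢ Finset.range (blockSize s t m k) : Finset (Fin (d * (s + t)) × ℕ)))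
    (θ : Fin (m + 2)) (hrow : ∀ r, ∃ x : PIRSymbol d s t m, θ ∈ x.2.1 ∧ row θ x = r)
    {u : Fin (m + 2) → Fin L → F} (h : ∀ x, ∑ i, u i ⬝ᵥ designVec row emb pt θ i x = 0) :
    u θ = 0 := by
  set a : (K : Finset (Fin (m + 2))) → ℕ → F := fun K e => ∑ i ∈ K, u i (emb θ i ⟨K, e⟩) with ha
  -- the interference carried by a symbol is the value of a polynomial
  have hint : ∀ (x : PIRSymbol d s t m) (K : Finset (Fin (m + 2))), x.2.1.erase θ = K →
      ∑ i ∈ K, u i ⬝ᵥ designVec row emb pt θ i x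
        = ∑ e : Fin (d * t * blockSize s t m (K.card - 1)), a K e
          * pt (K.card - 1) (x.1, symbolPosition θ x) ^ (e : ℕ) := by
    rintro x _ rfl
    simp only [ha, Finset.sum_mul]
    rw [Finset.sum_comm]
    refine Finset.sum_congr rfl fun i hi => ?_
    rw [designVec, if_pos (Finset.mem_of_mem_erase hi), if_neg (Finset.ne_of_mem_erase hi),
      dotProduct_vandermondeVec]
  have hsum : ∀ x : PIRSymbol d s t m, (∑ i ∈ x.2.1, u i ⬝ᵥ designVec row emb pt θ i x) = 0 := by
    intro x
    rw [← h x]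
    refine Finset.sum_subset (Finset.subset_univ _) fun i _ hi => ?_
    rw [designVec, if_neg hi, dotProduct_zero]
  have hpoly : ∀ K : Finset (Fin (m + 2)), θ ∉ K → K.Nonempty → ∀ y : F,
      ∑ e : Fin (d * t * blockSize s t m (K.card - 1)), a K e * y ^ (e : ℕ) = 0 := by
    intro K hθ hK
    have hcard := Finset.card_insert_of_notMem hθ
    have hle : (insert θ K).card ≤ m + 2 := by simpa using (insert θ K).card_le_univ
    have hk : K.card - 1 ≤ m := by omega
    refine sum_mul_pow_eq_zero (fun e => a K e)
      (S := Finset.univ.sigma fun j : Fin (d * (s + t)) => Finset.range (typeCount s t m K j))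
      (v := fun y => pt (K.card - 1) (y.1, y.2)) ?_ ?_ ?_
    · have hlt : ∀ y ∈ (Finset.univ.sigma fun j : Fin (d * (s + t)) =>
          Finset.range (typeCount s t m K j)), (y.1, y.2) ∈ (Finset.univ ×ˢ
          Finset.range (blockSize s t m (K.card - 1)) : Finset (Fin (d * (s + t)) × ℕ)) := by
        intro y hy
        have h1 := Finset.mem_range.1 (Finset.mem_sigma.1 hy).2
        have h2 := typeCount_add_insert hst hK hθ y.1
        exact Finset.mem_product.2 ⟨Finset.mem_univ _, Finset.mem_range.2 (by omega)⟩
      rintro ⟨j, c⟩ hy ⟨j', c'⟩ hy' heq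
      have := hpt _ hk (hlt _ hy) (hlt _ hy') heq
      obtain ⟨rfl, rfl⟩ := Prod.mk.inj this
      rfl
    · rw [Finset.card_sigma]
      simp only [Finset.card_range]
      rw [sum_typeCount hst d hK.ne_empty, blockSize,
        (by omega : m + 1 - (K.card - 1) = m - (K.card - 1) + 1), pow_succ]
      apply le_of_eq
      ring
    · rintro ⟨j, c⟩ hy
      have hc := Finset.mem_range.1 (Finset.mem_sigma.1 hy).2
      have h1 := hint ⟨j, K, ⟨c, hc⟩⟩ K (Finset.erase_eq_of_notMem hθ)
      have h2 := hsum ⟨j, K, ⟨c, hc⟩⟩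
      simp only [symbolPosition, if_neg hθ] at h1 h2
      exact h1.symm.trans h2
  funext r
  obtain ⟨x, hx, rfl⟩ := hrow r
  have h1 := hsum x
  rw [← Finset.add_sum_erase _ _ hx, hint x _ rfl] at h1
  have h2 : ∑ e : Fin (d * t * blockSize s t m ((x.2.1.erase θ).card - 1)), a (x.2.1.erase θ) e
      * pt ((x.2.1.erase θ).card - 1) (x.1, symbolPosition θ x) ^ (e : ℕ) = 0 := by
    rcases (x.2.1.erase θ).eq_empty_or_nonempty with h0 | h0
    · rw [h0]
      simp [ha]
    · exact hpoly _ (Finset.notMem_erase θ _) h0 _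
  rw [h2, add_zero, designVec, if_pos hx, if_pos rfl, dotProduct_single, mul_one] at h1
  exact h1

/-- At any `d t` servers, at most as many coordinates of a block are seen as the dimension of its
code; a functional that isolates one of them comes from the polynomial that vanishes at the
others. -/
theorem linearIndependent_designVec (hst : 0 < s + t)
    (hpt : ∀ k ≤ m, Set.InjOn (pt k)
      (Finset.univ ×ˢ Finset.range (blockSize s t m k) : Finset (Fin (d * (s + t)) × ℕ)))
    (θ i : Fin (m + 2)) (hrow : Set.InjOn (row θ) {x | θ ∈ x.2.1})
    (hemb : i ≠ θ → Set.InjOn (emb θ i) {y | (i ∈ y.1 ∧ θ ∉ y.1) ∧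
      y.2 < d * t * blockSize s t m (y.1.card - 1)})
    {Γ : Finset (Fin (d * (s + t)))} (hΓ : Γ.card ≤ d * t) :
    LinearIndependent F fun x : {x : PIRSymbol d s t m // x.1 ∈ Γ ∧ i ∈ x.2.1} =>
      designVec row emb pt θ i x := by
  apply linearIndependent_of_exists_functional
  rintro ⟨x, hxΓ, hxi⟩
  by_cases hi : i = θ
  · subst hi
    refine ⟨LinearMap.proj (row i x), ?_, ?_⟩
    · simp [designVec, hxi]
    · rintro ⟨y, hyΓ, hyi⟩ hne
      have : row i x ≠ row i y := fun h => hne (Subtype.ext (hrow hyi hxi h.symm))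
      simp [designVec, hyi, this]
  have hemb' := hemb hi
  set K := x.2.1.erase θ with hK
  have hiK : i ∈ K := Finset.mem_erase.2 ⟨hi, hxi⟩
  have hθK : θ ∉ K := Finset.notMem_erase θ _
  set k := K.card - 1 with hkdef
  have hk : k ≤ m := by
    have h1 := Finset.card_insert_of_notMem hθK
    have h2 : (insert θ K).card ≤ m + 2 := by simpa using (insert θ K).card_le_univ
    omega
  set D := d * t * blockSize s t m k with hD
  set R := (Γ ×ˢ Finset.range (blockSize s t m k)).erase (x.1, symbolPosition θ x) with hR
  have hmem : ∀ y : PIRSymbol d s t m, y.1 ∈ Γ → i ∈ y.2.1 → y.2.1.erase θ = K →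
      (y.1, symbolPosition θ y) ∈ Γ ×ˢ Finset.range (blockSize s t m k) := by
    intro y hy hyi hyK
    have := symbolPosition_lt hst hi hyi
    rw [hyK] at this
    exact Finset.mem_product.2 ⟨hy, Finset.mem_range.2 this⟩
  have hsub : ∀ z ∈ Γ ×ˢ Finset.range (blockSize s t m k), z ∈ (Finset.univ ×ˢ
      Finset.range (blockSize s t m k) : Finset (Fin (d * (s + t)) × ℕ)) := fun z hz =>
    Finset.mem_product.2 ⟨Finset.mem_univ _, (Finset.mem_product.1 hz).2⟩
  set p : Polynomial F := ∏ z ∈ R, (Polynomial.X - Polynomial.C (pt k z)) with hp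
  have hpdeg : p.natDegree < D := by
    have h1 : p.natDegree = R.card := Polynomial.natDegree_finsetProd_X_sub_C_eq_card R _
    have h2 := Finset.card_erase_lt_of_mem (hmem x hxΓ hxi rfl)
    rw [Finset.card_product, Finset.card_range] at h2
    rw [h1]
    exact h2.trans_le (Nat.mul_le_mul_right _ hΓ)
  set φ : (Fin L → F) →ₗ[F] F :=
    ∑ e : Fin D, p.coeff e • LinearMap.proj (emb θ i ⟨K, e⟩) with hφ
  have hφ_same : ∀ y : PIRSymbol d s t m, i ∈ y.2.1 → y.2.1.erase θ = K →
      φ (designVec row emb pt θ i y) = p.eval (pt k (y.1, symbolPosition θ y)) := by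
    intro y hyi hyK
    rw [designVec, if_pos hyi, if_neg hi, hyK, Polynomial.eval_eq_sum_range' hpdeg,
      ← Fin.sum_univ_eq_sum_range fun e => p.coeff e * pt k (y.1, symbolPosition θ y) ^ e, hφ,
      LinearMap.sum_apply]
    refine Finset.sum_congr rfl fun e _ => ?_
    rw [LinearMap.smul_apply, LinearMap.proj_apply, smul_eq_mul, vandermondeVec, Finset.sum_apply,
      Finset.sum_eq_single e]
    · rw [Pi.single_eq_same]
    · intro e' _ hne
      refine Pi.single_eq_of_ne (fun heq => hne ?_) _
      have := hemb' (x₁ := ⟨K, e⟩) ⟨⟨hiK, hθK⟩, e.2⟩ (x₂ := ⟨K, e'⟩) ⟨⟨hiK, hθK⟩, e'.2⟩ heq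
      have h2 := eq_of_heq (Sigma.mk.inj this).2
      exact Fin.ext h2.symm
    · exact fun h => absurd (Finset.mem_univ e) h
  have hφ_other : ∀ y : PIRSymbol d s t m, i ∈ y.2.1 → y.2.1.erase θ ≠ K →
      φ (designVec row emb pt θ i y) = 0 := by
    intro y hyi hyK
    rw [designVec, if_pos hyi, if_neg hi, hφ, LinearMap.sum_apply]
    refine Finset.sum_eq_zero fun e _ => ?_
    rw [LinearMap.smul_apply, LinearMap.proj_apply, vandermondeVec, Finset.sum_apply,
      Finset.sum_eq_zero, smul_zero]
    intro e' _
    refine Pi.single_eq_of_ne (fun heq => hyK ?_) _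
    have := hemb' (x₁ := ⟨K, e⟩) ⟨⟨hiK, hθK⟩, e.2⟩ (x₂ := ⟨y.2.1.erase θ, e'⟩)
      ⟨⟨Finset.mem_erase.2 ⟨hi, hyi⟩, Finset.notMem_erase θ _⟩, e'.2⟩ heq
    exact (Sigma.mk.inj this).1.symm
  have heval : ∀ z, p.eval (pt k z) = ∏ z' ∈ R, (pt k z - pt k z') := fun z => by
    simp [hp, Polynomial.eval_prod]
  refine ⟨φ, ?_, ?_⟩
  · change φ (designVec row emb pt θ i x) ≠ 0
    rw [hφ_same x hxi rfl, heval, Finset.prod_ne_zero_iff]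
    intro z hz
    rw [sub_ne_zero]
    intro heq
    exact Finset.ne_of_mem_erase hz (hpt k hk (hsub _ (Finset.mem_of_mem_erase hz))
      (hsub _ (hmem x hxΓ hxi rfl)) heq.symm)
  · rintro ⟨y, hyΓ, hyi⟩ hne
    change φ (designVec row emb pt θ i y) = 0
    by_cases hyK : y.2.1.erase θ = K
    · rw [hφ_same y hyi hyK, heval]
      refine Finset.prod_eq_zero (Finset.mem_erase.2 ⟨fun heq => hne (Subtype.ext ?_),
        hmem y hyΓ hyi hyK⟩) (sub_self _)
      obtain ⟨h1, h2⟩ := Prod.mk.inj heq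
      exact eq_of_symbolPosition_eq h1 hyK h2
    · exact hφ_other y hyi hyK

end Design

/-- The design of the optimal scheme, over every sufficiently large field. -/
theorem exists_columnDesign {d s t m : ℕ} (hd : 0 < d) (hs : 0 < s) (F : Type) [Field F] [Fintype F]
    (hF : ∀ k ≤ m, d * (s + t) * blockSize s t m k ≤ Fintype.card F) :
    ∃ D : ColumnDesign F (m + 2) (d * (s + t)) (d * (s + t) ^ (m + 1)) (d * t),
      (∑ j, Fintype.card (D.Col j) : ℕ)
        = (d * (s + t) ^ (m + 1) : ℕ) * downloadCost (d * (s + t)) (d * t) (m + 2) := by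
  classical
  have hst : 0 < s + t := by omega
  have : NeZero (d * (s + t) ^ (m + 1)) := ⟨by positivity⟩
  have hpt : ∀ k, ∃ f : Fin (d * (s + t)) × ℕ → F, k ≤ m → Set.InjOn f
      (Finset.univ ×ˢ Finset.range (blockSize s t m k) : Finset (Fin (d * (s + t)) × ℕ)) := by
    intro k
    by_cases hk : k ≤ m
    · obtain ⟨f, hf⟩ := exists_injOn_of_card_le (β := F) (B := (Finset.univ ×ˢ
        Finset.range (blockSize s t m k) : Finset (Fin (d * (s + t)) × ℕ)))
        (by simpa [Finset.card_product] using hF k hk)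
      exact ⟨f, fun _ => hf⟩
    · exact ⟨fun _ => 0, fun h => absurd h hk⟩
  have hrow : ∀ θ : Fin (m + 2), ∃ f : PIRSymbol d s t m → Fin (d * (s + t) ^ (m + 1)),
      Set.InjOn f {x | θ ∈ x.2.1} ∧ ∀ r, ∃ x : PIRSymbol d s t m, θ ∈ x.2.1 ∧ f x = r := by
    intro θ
    set B := Finset.univ.filter fun x : PIRSymbol d s t m => θ ∈ x.2.1 with hB
    have hcard : B.card = d * (s + t) ^ (m + 1) := by
      rw [← sum_typeCount_mem hst d θ, hB, Finset.card_filter, Fintype.sum_sigma]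
      refine Finset.sum_congr rfl fun j _ => ?_
      rw [Fintype.sum_sigma]
      refine Finset.sum_congr rfl fun K _ => ?_
      split_ifs <;> simp
    obtain ⟨f, hf⟩ := exists_injOn_of_card_le (β := Fin (d * (s + t) ^ (m + 1))) (B := B)
      (by rw [hcard, Fintype.card_fin])
    refine ⟨f, by simpa [hB] using hf, fun r => ?_⟩
    have himg : B.image f = Finset.univ := by
      rw [← Finset.card_eq_iff_eq_univ, Finset.card_image_of_injOn hf, hcard, Fintype.card_fin]
    obtain ⟨x, hx, hxr⟩ := Finset.mem_image.1 (himg ▸ Finset.mem_univ r)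
    exact ⟨x, (Finset.mem_filter.1 hx).2, hxr⟩
  have hemb : ∀ θ i : Fin (m + 2), ∃ f : (Σ _ : Finset (Fin (m + 2)), ℕ) →
      Fin (d * (s + t) ^ (m + 1)), i ≠ θ → Set.InjOn f {y | (i ∈ y.1 ∧ θ ∉ y.1) ∧
        y.2 < d * t * blockSize s t m (y.1.card - 1)} := by
    intro θ i
    by_cases hi : i = θ
    · exact ⟨fun _ => 0, fun h => absurd hi h⟩
    obtain ⟨f, hf⟩ := exists_injOn_of_card_le (β := Fin (d * (s + t) ^ (m + 1)))
      (B := (Finset.univ.filter fun K : Finset (Fin (m + 2)) => i ∈ K ∧ θ ∉ K).sigma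
        fun K => Finset.range (d * t * blockSize s t m (K.card - 1)))
      (by
        rw [Finset.card_sigma, Fintype.card_fin]
        simpa using sum_interferenceDim_le d hi)
    refine ⟨f, fun _ y hy z hz => hf ?_ ?_⟩
    · simpa using hy
    · simpa using hz
  choose pt hpt using hpt
  choose row hrow_inj hrow_surj using hrow
  choose emb hemb using hemb
  refine ⟨{
    Col := fun j => Σ K : Finset (Fin (m + 2)), Fin (typeCount s t m K j)
    Active := fun i x => i ∈ x.2.1
    vec := designVec row emb pt
    vec_eq_zero := fun θ i x hx => if_neg hx
    linearIndependent := fun θ i Γ hΓ =>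
      linearIndependent_designVec hst hpt θ i (hrow_inj θ) (hemb θ i) hΓ
    decode := fun θ u h => eq_zero_of_dotProduct_designVec hst hpt θ (hrow_surj θ) h }, ?_⟩
  have hcount := mul_sum_typeCount (m := m) hst d
  simp only [Fintype.card_sigma, Fintype.card_fin]
  have hs' : (s : ℝ) ≠ 0 := by exact_mod_cast hs.ne'
  have hd' : (d : ℝ) ≠ 0 := by exact_mod_cast hd.ne'
  have hn' : (s : ℝ) + t ≠ 0 := by exact_mod_cast hst.ne'
  have hgeom := mul_neg_geom_sum ((t : ℝ) / (s + t)) (m + 2)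
  have hcost : downloadCost (d * (s + t)) (d * t) (m + 2)
      = ∑ k ∈ Finset.range (m + 2), ((t : ℝ) / (s + t)) ^ k := by
    unfold downloadCost
    push_cast
    rw [mul_div_mul_left _ _ hd']
  rw [← hcost, one_sub_div hn', add_sub_cancel_right, div_pow] at hgeom
  have hcount' : (s : ℝ) * (∑ j : Fin (d * (s + t)), ∑ K : Finset (Fin (m + 2)),
      typeCount s t m K j : ℕ) + d * t ^ (m + 2) = d * (s + t) ^ (m + 2) := by
    exact_mod_cast hcount
  refine mul_left_cancel₀ hs' ?_
  rw [eq_sub_of_add_eq hcount']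
  field_simp at hgeom
  push_cast
  rw [pow_succ _ (m + 1)] at hgeom ⊢
  refine mul_left_cancel₀ hn' ?_
  linear_combination (-(d : ℝ)) * hgeom

/-! ### The capacity and the optimal sub-packetization -/

theorem mul_blockSize_le {s t m k q c : ℕ} (hk : k ≤ m) (h : max (c * t ^ m) (c * s ^ m) ≤ q) :
    c * blockSize s t m k ≤ q := by
  obtain ⟨l, rfl⟩ := Nat.exists_eq_add_of_le hk
  rw [blockSize, Nat.add_sub_cancel_left]
  rcases le_total s t with hst | hst
  · refine le_trans (Nat.mul_le_mul_left c ?_) ((le_max_left _ _).trans h)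
    rw [pow_add]
    gcongr
  · refine le_trans (Nat.mul_le_mul_left c ?_) ((le_max_right _ _).trans h)
    rw [pow_add]
    gcongr

theorem exists_linearPIRScheme {d s t m : ℕ} (hd : 0 < d) (hs : 0 < s) (ht : 0 < t) (F : Type)
    [Field F] [Fintype F]
    (hF : max (d * (s + t) * t ^ m) (d * (s + t) * s ^ m) ≤ Fintype.card F) :
    ∃ S : LinearPIRScheme F (m + 2) (d * (s + t)) (d * (s + t) ^ (m + 1)),
      S.toPIRScheme.IsTPrivatePIR (d * t) ∧
        S.toPIRScheme.HasRate (1 / downloadCost (d * (s + t)) (d * t) (m + 2)) := by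
  obtain ⟨D, hD⟩ := exists_columnDesign hd hs F fun k hk => mul_blockSize_le hk hF
  refine ⟨D.toLinearPIRScheme, D.isTPrivatePIR, D.hasRate (Nat.mul_pos hd ht) ?_ ?_ hD⟩
  · exact Nat.mul_lt_mul_of_pos_left (by omega) hd
  · positivity

/-- A finite field of prime order is large enough for the scheme that attains the bound. -/
theorem pirCapacity_eq {d s t m : ℕ} (hd : 0 < d) (hs : 0 < s) (ht : 0 < t) :
    pirCapacity (m + 2) (d * (s + t)) (d * t)
      = 1 / downloadCost (d * (s + t)) (d * t) (m + 2) := by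
  have hT : 1 ≤ d * t := Nat.mul_pos hd ht
  have hTN : d * t < d * (s + t) := Nat.mul_lt_mul_of_pos_left (by omega) hd
  refine IsGreatest.csSup_eq ⟨?_, ?_⟩
  · obtain ⟨p, hp, hprime⟩ := Nat.exists_infinite_primes
      (max (d * (s + t) * t ^ m) (d * (s + t) * s ^ m))
    have : Fact p.Prime := ⟨hprime⟩
    obtain ⟨S, h1, h2⟩ := exists_linearPIRScheme (m := m) hd hs ht (ZMod p) (by rwa [ZMod.card])
    exact ⟨S.toPIRScheme, h1, h2⟩
  · rintro R ⟨P, hP, hR⟩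
    rw [← hR 0]
    exact PIRScheme.rate_le hP hT hTN 0

theorem mainTheorem2 (M N T d n t : ℕ) (hM : 2 ≤ M) (hT : 1 ≤ T) (hTN : T < N)
    (hd : d = Nat.gcd N T) (hn : n = N / d) (ht : t = T / d) :
    IsLeast {L : ℕ | IsAchievableSubpacketization M N T L} (d * n ^ (M - 1)) ∧
      ∀ (F : Type) [Field F] [Fintype F],
        max (N * t ^ (M - 2)) (N * (n - t) ^ (M - 2)) ≤ Fintype.card F →
          ∃ S : LinearPIRScheme F M N (d * n ^ (M - 1)),
            S.IsCapacityAchieving T ∧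
              S.toPIRScheme.HasRate ((1 - (T : ℝ) / N) / (1 - ((T : ℝ) / N) ^ M)) := by
  have hgcd : 0 < Nat.gcd N T := Nat.gcd_pos_of_pos_right N hT
  have hd0 : 0 < d := hd ▸ hgcd
  have hdN : N = d * n := by rw [hn, Nat.mul_div_cancel' (hd ▸ Nat.gcd_dvd_left N T)]
  have hdT : T = d * t := by rw [ht, Nat.mul_div_cancel' (hd ▸ Nat.gcd_dvd_right N T)]
  have hcop : Nat.Coprime n t := by
    rw [hn, ht, hd]
    exact Nat.coprime_div_gcd_div_gcd hgcd
  clear hd hn ht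
  subst hdN hdT
  have ht0 : 0 < t := Nat.pos_of_mul_pos_left hT
  have htn : t < n := lt_of_mul_lt_mul_left hTN d.zero_le
  obtain ⟨s, rfl⟩ := Nat.exists_eq_add_of_le' htn.le
  obtain ⟨m, rfl⟩ := Nat.exists_eq_add_of_le' hM
  have hs0 : 0 < s := by omega
  have hcap := pirCapacity_eq (m := m) hd0 hs0 ht0
  have hscheme : ∀ (F : Type) [Field F] [Fintype F],
      max (d * (s + t) * t ^ m) (d * (s + t) * s ^ m) ≤ Fintype.card F →
        ∃ S : LinearPIRScheme F (m + 2) (d * (s + t)) (d * (s + t) ^ (m + 1)),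
          S.IsCapacityAchieving (d * t) ∧
            S.toPIRScheme.HasRate (1 / downloadCost (d * (s + t)) (d * t) (m + 2)) := by
    intro F _ _ hF
    obtain ⟨S, h1, h2⟩ := exists_linearPIRScheme hd0 hs0 ht0 F hF
    exact ⟨S, ⟨h1, hcap ▸ h2⟩, h2⟩
  refine ⟨⟨?_, ?_⟩, ?_⟩
  · obtain ⟨p, hp, hprime⟩ := Nat.exists_infinite_primes
      (max (d * (s + t) * t ^ m) (d * (s + t) * s ^ m))
    have : Fact p.Prime := ⟨hprime⟩
    obtain ⟨S, hS, -⟩ := hscheme (ZMod p) (by rwa [ZMod.card])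
    exact ⟨ZMod p, inferInstance, inferInstance, S, hS⟩
  · rintro L ⟨F, _, _, S, hS⟩
    exact S.le_subpacketization hM hT hTN rfl rfl hcop hS.1 (hcap ▸ hS.2)
  · intro F _ _ hF
    rw [← one_div_downloadCost hTN]
    rw [Nat.add_sub_cancel, Nat.add_sub_cancel] at hF
    exact hscheme F hF
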